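/- Let $w_0:[0,\infty)\to[0,\infty)$ be Lebesgue measurable and, in each $\mathbb R^n$, let $w(x)=w_0(|x|)$ and $d\mu_n(x)=w(x)\,dx$, where $|\cdot|$ is the Euclidean norm. The following are equivalent. (i) There are $N\in\mathbb N$ and a constant $K_1>0$ such that for every $n\ge N$ the measure $\mu_n$ is locally finite and $$\mu_n(B(y,R))\le K_1\,\mu_n(B(x,R))\qquad\text{for all }R>0\text{ and all }x,y\in\mathbb R^n\text{ with }B(x,R)\cap B(y,R)\ne\emptyset,$$ where $B(x,R)$ denotes the open Euclidean ball (that is, $\mu_n$ is weakly doubling in $\mathbb R^n$, uniformly in $n\ge N$). (ii) $w$ is essentially constant on dyadic annuli: there is $\beta\ge 1$ such that in every $\mathbb R^n$, $n\ge 1$, and for all $R>0$, $$\operatorname*{ess\,sup}_{R\le|x|\le 2R} w(x)\;\le\;\beta\,\operatorname*{ess\,inf}_{R\le|x|\le 2R} w(x).$$ (iii) There are a dimension $n\ge1$ and a $\beta\ge1$ for which the inequality in (ii) holds in $\mathbb R^n$ for all $R>0$. -/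

import Mathlib

open MeasureTheory
open scoped NNReal ENNReal

noncomputable section

/-- The measure `dμ(x) = w₀(|x|) dx` on Euclidean space `ℝⁿ`. -/
def radialMeasure (w₀ : ℝ≥0 → ℝ≥0) (n : ℕ) : Measure (EuclideanSpace ℝ (Fin n)) :=
  volume.withDensity fun x => (w₀ ‖x‖₊ : ℝ≥0∞)

/-- `μ` is weakly doubling with constant `K`: two intersecting open balls with the same radius
have comparable measures. -/
def IsWeaklyDoublingWith {X : Type*} [PseudoMetricSpace X] [MeasurableSpace X]
    (μ : Measure X) (K : ℝ≥0) : Prop :=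
  ∀ (x y : X) (R : ℝ), 0 < R → (Metric.ball x R ∩ Metric.ball y R).Nonempty →
    μ (Metric.ball y R) ≤ K * μ (Metric.ball x R)

/-- The radial measures with density `w₀(|x|)` are (locally finite and) weakly doubling in `ℝⁿ`
for every `n ≥ N`, with one constant for all these dimensions. -/
def UniformlyWeaklyDoublingFrom (w₀ : ℝ≥0 → ℝ≥0) (N : ℕ) : Prop :=
  ∃ K : ℝ≥0, 0 < K ∧ ∀ n : ℕ, N ≤ n →
    IsLocallyFiniteMeasure (radialMeasure w₀ n) ∧ IsWeaklyDoublingWith (radialMeasure w₀ n) K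

/-- The closed dyadic annulus `{x ∈ ℝⁿ : R ≤ |x| ≤ 2R}`. -/
def dyadicAnnulus (n : ℕ) (R : ℝ) : Set (EuclideanSpace ℝ (Fin n)) :=
  {x | R ≤ ‖x‖ ∧ ‖x‖ ≤ 2 * R}

/-- `w(x) = w₀(|x|)` is essentially constant, with constant `β`, on the dyadic annuli of `ℝⁿ`:
the essential supremum over each annulus is at most `β` times the essential infimum. Both are
taken in `[0, ∞]` and with respect to Lebesgue measure on the annulus. -/
def EssConstOnDyadicAnnuli (w₀ : ℝ≥0 → ℝ≥0) (n : ℕ) (β : ℝ≥0) : Prop :=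
  ∀ R : ℝ, 0 < R →
    essSup (fun x => (w₀ ‖x‖₊ : ℝ≥0∞)) (volume.restrict (dyadicAnnulus n R)) ≤
      β * essInf (fun x => (w₀ ‖x‖₊ : ℝ≥0∞)) (volume.restrict (dyadicAnnulus n R))

end

/-! In polar coordinates a property of `‖x‖` holds almost everywhere in `ℝⁿ`, n ≥ 1, exactly when it
holds for almost every positive radius. Both annulus conditions are therefore one condition on the
line, `EssConstOnDyadicIntervals`, in which the dimension no longer appears.

If the weight g is essentially constant on dyadic intervals, its size near radius r is a profile
that changes by at most a fixed factor when r is doubled. On a ball B(x,R) away from the origin, g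
is comparable to the profile at ρ = |x|+R. Towards the origin g may grow by β² per halving of the
radius, but volumes shrink by 2⁻ⁿ; once 2β² ≤ 2ⁿ the shells sum to a geometric series. So μ(B(x,R))
is comparable to profile times volume, with constants free of n (`setLIntegral_ball_le`,
`le_setLIntegral_ball`), and the profiles of intersecting balls are comparable.

Conversely, volume in high dimension concentrates. Slice the ball of radius R centred at s on an
axis into chords parallel to the axis: nearly all its volume lies on chords that are short, at
distance nearly R from the axis, where the norm is close to √(s²+R²). Averaging over centres within
κ of s turns ball masses into integrals of g over intervals of length of order κ around √(s²+R²). A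
chain of intersecting balls compares two centres s₁, s₂. Letting the dimension tend to infinity
removes the long chords (`setLIntegral_closedBall_le_of_forall_dim`); letting κ → 0, Lebesgue
differentiation compares the values of g at the two radii
(`essConstOnDyadicIntervals_of_forall_dim`). -/

open Set Filter Metric Module Topology

/-! ### Polar coordinates and null sets. -/

section Polar

variable {E : Type*} [NormedAddCommGroup E] [NormedSpace ℝ E] [MeasurableSpace E] [BorelSpace E]
  [FiniteDimensional ℝ E] [Nontrivial E] (μ : Measure E) [μ.IsAddHaarMeasure]

/-- Integration of radial functions in polar coordinates. -/
theorem lintegral_fun_norm {f : ℝ → ℝ≥0∞} (hf : Measurable f) :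
    ∫⁻ x, f ‖x‖ ∂μ = μ.toSphere univ *
      ∫⁻ r in Ioi (0 : ℝ), ENNReal.ofReal (r ^ (finrank ℝ E - 1)) * f r := by
  calc
    ∫⁻ x, f ‖x‖ ∂μ = ∫⁻ x : ({(0)}ᶜ : Set E), f ‖x.1‖ ∂(μ.comap (↑)) := by
      rw [lintegral_subtype_comap (measurableSet_singleton _).compl fun x ↦ f ‖x‖,
        restrict_compl_singleton]
    _ = ∫⁻ x, f x.2 ∂μ.toSphere.prod (.volumeIoiPow (finrank ℝ E - 1)) := by
      simpa using μ.measurePreserving_homeomorphUnitSphereProd.lintegral_comp_emb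
        (Homeomorph.measurableEmbedding _) (f ∘ Subtype.val ∘ Prod.snd)
    _ = μ.toSphere univ * ∫⁻ x : Ioi (0 : ℝ), f x ∂.volumeIoiPow (finrank ℝ E - 1) := by
      rw [lintegral_prod _ (by fun_prop)]
      simp [mul_comm]
    _ = _ := by
      rw [Measure.volumeIoiPow, lintegral_withDensity_eq_lintegral_mul _ (by fun_prop)
        (by fun_prop),
        ← lintegral_subtype_comap measurableSet_Ioi]
      rfl

theorem ae_comap_subtype_iff {α : Type*} [MeasurableSpace α] (ν : Measure α) {s : Set α}
    (hs : MeasurableSet s) {q : α → Prop} :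
    (∀ᵐ x : s ∂ν.comap ((↑) : s → α), q x) ↔ ∀ᵐ x ∂ν, x ∈ s → q x := by
  have hν : (ν.comap ((↑) : s → α)).map (↑) = ν.restrict s := map_comap_subtype_coe hs ν
  have h := (MeasurableEmbedding.subtype_coe hs).ae_map_iff (μ := ν.comap ((↑) : s → α)) (p := q)
  rw [hν, ae_restrict_iff' hs] at h
  exact h.symm

/-- A property of the norm holds almost everywhere if and only if it holds for almost every
positive number. -/
theorem ae_norm_iff {p : ℝ → Prop} :
    (∀ᵐ x ∂μ, p ‖x‖) ↔ ∀ᵐ r : ℝ, 0 < r → p r := by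
  -- The density r ^ n is positive on the half-line, so it has the same null sets as Lebesgue
  -- measure.
  have hpow (n : ℕ) (q : Ioi (0 : ℝ) → Prop) :
      (∀ᵐ r ∂Measure.volumeIoiPow n, q r) ↔
        ∀ᵐ r ∂Measure.comap ((↑) : Ioi (0 : ℝ) → ℝ) volume, q r := by
    rw [Measure.volumeIoiPow, ae_withDensity_iff (by fun_prop)]
    refine eventually_congr (.of_forall fun r ↦ ?_)
    have : ENNReal.ofReal (r.1 ^ n) ≠ 0 := by
      simpa using pow_pos r.2 n
    simp [this]
  have h0 : (∀ᵐ x ∂μ, p ‖x‖) ↔ ∀ᵐ x ∂μ, x ∈ ({0}ᶜ : Set E) → p ‖x‖ := by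
    refine ⟨fun h ↦ h.mono fun x hx _ ↦ hx, fun h ↦ ?_⟩
    filter_upwards [h, compl_mem_ae_iff.2 (measure_singleton (μ := μ) (0 : E))] with x hx hx'
      using hx hx'
  rw [h0, ← ae_comap_subtype_iff μ (measurableSet_singleton _).compl,
    show (∀ᵐ r : ℝ, 0 < r → p r) ↔ ∀ᵐ r : ℝ, r ∈ Ioi (0 : ℝ) → p r from Iff.rfl,
    ← ae_comap_subtype_iff volume measurableSet_Ioi, ← hpow (finrank ℝ E - 1)]
  have key := μ.measurePreserving_homeomorphUnitSphereProd
  have hemb := (homeomorphUnitSphereProd E).measurableEmbedding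
  have : (∀ᵐ x : ({0}ᶜ : Set E) ∂μ.comap (↑), p ‖(x : E)‖) ↔
      ∀ᵐ y ∂(μ.toSphere.prod (Measure.volumeIoiPow (finrank ℝ E - 1))), p y.2 := by
    rw [← key.map_eq, hemb.ae_map_iff]
    simp
  rw [this, ae_iff, ae_iff]
  have hset : {a : sphere (0 : E) 1 × Ioi (0 : ℝ) | ¬p a.2} = univ ×ˢ {r : Ioi (0 : ℝ) | ¬ p r} := by
    ext; simp
  -- The product formula holds for rectangles with arbitrary sides, so `p` need not be measurable.
  rw [hset, Measure.prod_prod, mul_eq_zero, Measure.measure_univ_eq_zero,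
    or_iff_right μ.toSphere_ne_zero]

end Polar

/-! ### Reduction from annuli to intervals of the half-line. -/

/-- A function has essential supremum at most `β` times its essential infimum if and only if almost
all pairs of its values are comparable with constant `β`. -/
theorem essSup_le_mul_essInf_iff {α : Type*} [MeasurableSpace α] {μ : Measure α} {f : α → ℝ≥0∞}
    {β : ℝ≥0} (hβ : 1 ≤ β) :
    essSup f μ ≤ β * essInf f μ ↔ ∀ᵐ x ∂μ, ∀ᵐ y ∂μ, f x ≤ β * f y := by
  have hβ0 : (β : ℝ≥0∞) ≠ 0 := by simpa using (zero_lt_one.trans_le hβ).ne'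
  constructor
  · intro h
    filter_upwards [ENNReal.ae_le_essSup f] with x hx
    filter_upwards [ae_essInf_le (f := f)] with y hy
    calc f x ≤ essSup f μ := hx
      _ ≤ β * essInf f μ := h
      _ ≤ β * f y := by gcongr
  · intro h
    refine essSup_le_of_ae_le _ ?_
    filter_upwards [h] with x hx
    rw [mul_comm, ← ENNReal.div_le_iff hβ0 ENNReal.coe_ne_top]
    refine le_essInf_of_ae_le _ ?_
    filter_upwards [hx] with y hy
    rw [ENNReal.div_le_iff hβ0 ENNReal.coe_ne_top, mul_comm]
    exact hy

/-- The function `g` on the line is essentially constant, with constant `β`, on the dyadic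
intervals of the positive half-line. -/
def EssConstOnDyadicIntervals (g : ℝ → ℝ≥0∞) (β : ℝ≥0) : Prop :=
  ∀ R : ℝ, 0 < R → ∀ᵐ r, R ≤ r ∧ r ≤ 2 * R → ∀ᵐ s, R ≤ s ∧ s ≤ 2 * R → g r ≤ β * g s

theorem measurableSet_dyadicAnnulus (n : ℕ) (R : ℝ) : MeasurableSet (dyadicAnnulus n R) := by
  apply MeasurableSet.inter
  · exact measurableSet_le measurable_const measurable_norm
  · exact measurableSet_le measurable_norm measurable_const

/-- The right side is independent of `n`; this is what transfers the condition from one dimension to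
all. -/
theorem essConstOnDyadicAnnuli_iff {w₀ : ℝ≥0 → ℝ≥0} {n : ℕ} (hn : 1 ≤ n) {β : ℝ≥0} (hβ : 1 ≤ β) :
    EssConstOnDyadicAnnuli w₀ n β ↔
      EssConstOnDyadicIntervals (fun t ↦ (w₀ t.toNNReal : ℝ≥0∞)) β := by
  have : Nonempty (Fin n) := ⟨⟨0, hn⟩⟩
  refine forall₂_congr fun R hR ↦ ?_
  have key (p : ℝ → Prop) : (∀ᵐ x ∂(volume.restrict (dyadicAnnulus n R)), p ‖x‖) ↔
      ∀ᵐ r, R ≤ r ∧ r ≤ 2 * R → p r := by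
    rw [ae_restrict_iff' (measurableSet_dyadicAnnulus n R)]
    refine (ae_norm_iff (volume : Measure (EuclideanSpace ℝ (Fin n)))
      (p := fun r ↦ R ≤ r ∧ r ≤ 2 * R → p r)).trans (eventually_congr (.of_forall fun r ↦ ?_))
    exact ⟨fun h h' ↦ h (hR.trans_le h'.1) h', fun h _ ↦ h⟩
  rw [essSup_le_mul_essInf_iff hβ, ← key]
  refine eventually_congr (.of_forall fun x ↦ ?_)
  rw [← key]
  simp only [norm_toNNReal]

/-! ### The dyadic profile and its growth. -/

section Profile

variable {g : ℝ → ℝ≥0∞} {β : ℝ≥0}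

theorem exists_mem_Icc_of_ae {p : ℝ → Prop} (h : ∀ᵐ r, p r) {a b : ℝ} (hab : a < b) :
    ∃ r, a ≤ r ∧ r ≤ b ∧ p r := by
  have hpos : volume (Icc a b) ≠ 0 := by simpa using hab
  obtain ⟨r, hr, hp⟩ := Measure.exists_mem_of_measure_ne_zero_of_ae hpos (ae_restrict_of_ae h)
  exact ⟨r, hr.1, hr.2, hp⟩

/-- The value of `g` on the dyadic interval `[R, 2R]`, up to the factor `β`. -/
noncomputable def dyadicProfile (g : ℝ → ℝ≥0∞) (R : ℝ) : ℝ≥0∞ :=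
  essSup g (volume.restrict (Icc R (2 * R)))

theorem ae_dyadicProfile (hg : EssConstOnDyadicIntervals g β) (hβ : 1 ≤ β) {R : ℝ} (hR : 0 < R) :
    ∀ᵐ r, R ≤ r → r ≤ 2 * R → g r ≤ dyadicProfile g R ∧ dyadicProfile g R ≤ β * g r := by
  have h₁ : essSup g (volume.restrict (Icc R (2 * R))) ≤
      β * essInf g (volume.restrict (Icc R (2 * R))) := by
    rw [essSup_le_mul_essInf_iff hβ, ae_restrict_iff' measurableSet_Icc]
    filter_upwards [hg R hR] with r hr hrR
    rw [ae_restrict_iff' measurableSet_Icc]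
    exact hr hrR
  have h₂ := ENNReal.ae_le_essSup (μ := volume.restrict (Icc R (2 * R))) g
  have h₃ := ae_essInf_le (f := g) (μ := volume.restrict (Icc R (2 * R)))
  rw [ae_restrict_iff' measurableSet_Icc] at h₂ h₃
  filter_upwards [h₂, h₃] with r hr hr' h h'
  refine ⟨hr ⟨h, h'⟩, h₁.trans ?_⟩
  gcongr
  exact hr' ⟨h, h'⟩

theorem dyadicProfile_ne_top (hg : EssConstOnDyadicIntervals g β) (hβ : 1 ≤ β)
    (hfin : ∀ r, g r ≠ ∞) {R : ℝ} (hR : 0 < R) : dyadicProfile g R ≠ ∞ := by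
  obtain ⟨r, h₁, h₂, h⟩ := exists_mem_Icc_of_ae (ae_dyadicProfile hg hβ hR)
    (show R < 2 * R by linarith)
  exact ne_top_of_le_ne_top (ENNReal.mul_ne_top ENNReal.coe_ne_top (hfin r)) (h h₁ h₂).2

/-- The intervals [R, 2R] and [S, 2S] overlap in positive measure, so one value of `g` is comparable
to both profiles. -/
theorem dyadicProfile_le_of_lt (hg : EssConstOnDyadicIntervals g β) (hβ : 1 ≤ β) {R S : ℝ}
    (hR : 0 < R) (hRS : R ≤ S) (hS : S < 2 * R) :
    dyadicProfile g S ≤ β * dyadicProfile g R ∧ dyadicProfile g R ≤ β * dyadicProfile g S := by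
  obtain ⟨r, h₁, h₂, h, h'⟩ := exists_mem_Icc_of_ae
    ((ae_dyadicProfile hg hβ hR).and (ae_dyadicProfile hg hβ (hR.trans_le hRS))) hS
  replace h := h (by linarith) h₂
  replace h' := h' h₁ (by linarith)
  constructor
  · exact h'.2.trans (by gcongr; exact h.1)
  · exact h.2.trans (by gcongr; exact h'.1)

theorem dyadicProfile_le (hg : EssConstOnDyadicIntervals g β) (hβ : 1 ≤ β) {R S : ℝ}
    (hR : 0 < R) (hRS : R ≤ S) (hS : S ≤ 2 * R) :
    dyadicProfile g S ≤ (β : ℝ≥0∞) ^ 2 * dyadicProfile g R ∧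
      dyadicProfile g R ≤ (β : ℝ≥0∞) ^ 2 * dyadicProfile g S := by
  -- For S = 2R the two intervals share only an endpoint; the midpoint splits the passage into two
  -- overlapping ones, at the cost of a second factor `β`.
  set T := (R + S) / 2 with hT
  obtain ⟨h₁, h₂⟩ := dyadicProfile_le_of_lt hg hβ hR (S := T) (by linarith) (by linarith)
  obtain ⟨h₃, h₄⟩ := dyadicProfile_le_of_lt hg hβ (R := T) (S := S) (by linarith) (by linarith)
    (by linarith)
  rw [pow_two, mul_assoc, mul_assoc]
  exact ⟨h₃.trans (by gcongr), h₂.trans (by gcongr)⟩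

theorem dyadicProfile_le_pow (hg : EssConstOnDyadicIntervals g β) (hβ : 1 ≤ β) {R S : ℝ}
    (hR : 0 < R) (hRS : R ≤ S) (k : ℕ) (hS : S ≤ 2 ^ k * R) :
    dyadicProfile g S ≤ (β : ℝ≥0∞) ^ (2 * k) * dyadicProfile g R ∧
      dyadicProfile g R ≤ (β : ℝ≥0∞) ^ (2 * k) * dyadicProfile g S := by
  induction k generalizing S with
  | zero =>
    obtain rfl : S = R := le_antisymm (by simpa using hS) hRS
    simp
  | succ k ih =>
    set T := max R (S / 2)
    have hT : R ≤ T := le_max_left _ _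
    have hTS : T ≤ S := max_le hRS (by linarith)
    have hST : S / 2 ≤ T := le_max_right _ _
    have hTk : T ≤ 2 ^ k * R := by
      refine max_le ?_ ?_
      · exact le_mul_of_one_le_left hR.le (one_le_pow₀ one_le_two)
      · rw [pow_succ] at hS; linarith
    obtain ⟨h₁, h₂⟩ := ih hT hTk
    obtain ⟨h₃, h₄⟩ := dyadicProfile_le hg hβ (hR.trans_le hT) hTS (by linarith)
    rw [mul_add, mul_one]
    constructor
    · rw [add_comm, pow_add, mul_assoc]
      exact h₃.trans (by gcongr)
    · rw [pow_add, mul_assoc]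
      exact h₂.trans (by gcongr)

/-- The profile at ρ / 2 ^ (k + 1) controls `g` on this interval; k + 1 doublings bring it to ρ and
cost `β` ^ (2k + 2). The additional `β` in the second bound comes from comparing a profile with a
value. -/
theorem ae_le_dyadicProfile (hg : EssConstOnDyadicIntervals g β) (hβ : 1 ≤ β) {ρ : ℝ}
    (hρ : 0 < ρ) (k : ℕ) :
    ∀ᵐ r, ρ / 2 ^ (k + 1) ≤ r → r ≤ ρ / 2 ^ k →
      g r ≤ (β : ℝ≥0∞) ^ (2 * k + 2) * dyadicProfile g ρ ∧
        dyadicProfile g ρ ≤ (β : ℝ≥0∞) ^ (2 * k + 3) * g r := by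
  have hρ' : 0 < ρ / 2 ^ (k + 1) := by positivity
  have hle : ρ / 2 ^ (k + 1) ≤ ρ := div_le_self hρ.le (one_le_pow₀ one_le_two)
  have hle' : ρ ≤ 2 ^ (k + 1) * (ρ / 2 ^ (k + 1)) := by field_simp; rfl
  filter_upwards [ae_dyadicProfile hg hβ hρ'] with r hr h₁ h₂
  obtain ⟨h₃, h₄⟩ := hr h₁ (h₂.trans_eq (by rw [pow_succ]; field_simp))
  obtain ⟨h₅, h₆⟩ := dyadicProfile_le_pow hg hβ hρ' hle (k + 1) hle'
  refine ⟨h₃.trans h₆, h₅.trans ?_⟩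
  rw [pow_succ _ (2 * k + 2), mul_assoc]
  exact mul_le_mul' le_rfl h₄

end Profile

/-! ### Ball masses compared with profile times volume. -/

section Sufficiency

variable {E : Type*} [NormedAddCommGroup E] [NormedSpace ℝ E] [MeasurableSpace E] [BorelSpace E]
  [FiniteDimensional ℝ E] (μ : Measure E) [μ.IsAddHaarMeasure]
  {g : ℝ → ℝ≥0∞} {β : ℝ≥0}

theorem addHaar_ball_div_two_pow (x : E) {R : ℝ} (j : ℕ) :
    μ (ball 0 (R / 2 ^ j)) = (2⁻¹ ^ j) ^ finrank ℝ E * μ (ball x R) := by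
  have h : R / 2 ^ j = (2⁻¹ : ℝ) ^ j * R := by rw [inv_pow]; ring
  rw [h, Measure.addHaar_ball_mul_of_pos μ 0 (by positivity), Measure.addHaar_ball_center μ x]
  congr 1
  rw [ENNReal.ofReal_pow (by positivity), ENNReal.ofReal_pow (by positivity),
    ENNReal.ofReal_inv_of_pos two_pos, ENNReal.ofReal_ofNat]

variable [Nontrivial E]

/-- Sums over dyadic shells around the origin. The `j`-th shell lies in a closed ball of radius R /
2 ^ j because ρ ≤ 4R. -/
theorem setLIntegral_ball_zero_le (hg : EssConstOnDyadicIntervals g β) (hβ : 1 ≤ β)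
    (hdim : 2 * (β : ℝ≥0∞) ^ 2 ≤ 2 ^ finrank ℝ E) {ρ R : ℝ} (hρ : 0 < ρ) (hR : ρ ≤ 4 * R) (x : E) :
    ∫⁻ z in ball 0 (ρ / 4), g ‖z‖ ∂μ ≤
      2 * (β : ℝ≥0∞) ^ 6 * dyadicProfile g ρ * μ (ball x R) := by
  set s : ℕ → Set E := fun j ↦ {z | ρ / 2 ^ (j + 3) ≤ ‖z‖ ∧ ‖z‖ ≤ ρ / 2 ^ (j + 2)} with hs
  have hsm (j : ℕ) : MeasurableSet (s j) :=
    (measurableSet_le measurable_const measurable_norm).inter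
      (measurableSet_le measurable_norm measurable_const)
  have hcover : ball (0 : E) (ρ / 4) ≤ᵐ[μ] ⋃ j, s j := by
    filter_upwards [compl_mem_ae_iff.2 (measure_singleton (μ := μ) (0 : E))] with z hz0 hz
    replace hz : ‖z‖ < ρ / 4 := by simpa using mem_ball.1 hz
    have hz0' : 0 < ‖z‖ := norm_pos_iff.2 hz0
    obtain ⟨n, hn, hn'⟩ := exists_nat_pow_near (x := ρ / (4 * ‖z‖)) (y := (2 : ℝ))
      (by rw [one_le_div (by positivity)]; linarith) one_lt_two
    rw [le_div_iff₀ (by positivity)] at hn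
    rw [div_lt_iff₀ (by positivity), pow_succ] at hn'
    refine mem_iUnion.2 ⟨n, ?_, ?_⟩
    · rw [div_le_iff₀ (by positivity), pow_add]; linarith
    · rw [le_div_iff₀ (by positivity), pow_add]; linarith
  have hball (j : ℕ) : μ (s j) ≤ (2⁻¹ ^ j) ^ finrank ℝ E * μ (ball x R) := by
    rw [← addHaar_ball_div_two_pow μ x j, ← Measure.addHaar_closedBall_eq_addHaar_ball]
    refine measure_mono fun z hz ↦ mem_closedBall_zero_iff.2 (hz.2.trans ?_)
    rw [div_le_div_iff₀ (by positivity) (by positivity), pow_add]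
    nlinarith [pow_pos (two_pos : (0 : ℝ) < 2) j]
  have hterm (j : ℕ) : ∫⁻ z in s j, g ‖z‖ ∂μ ≤
      2⁻¹ ^ j * ((β : ℝ≥0∞) ^ 6 * dyadicProfile g ρ * μ (ball x R)) := by
    have hae := (ae_norm_iff μ (p := fun r ↦ ρ / 2 ^ (j + 3) ≤ r → r ≤ ρ / 2 ^ (j + 2) →
      g r ≤ (β : ℝ≥0∞) ^ (2 * (j + 2) + 2) * dyadicProfile g ρ)).2 (by
        filter_upwards [ae_le_dyadicProfile hg hβ hρ (j + 2)] with r hr _ h h' using (hr h h').1)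
    -- The growth `β` ^ (2j) of the weight meets the volume decay 2 ^ (-jn); `hdim` leaves a ratio
    -- of at most 1/2.
    have hpow : ((β : ℝ≥0∞) ^ 2) ^ j * (2⁻¹ ^ j) ^ finrank ℝ E ≤ 2⁻¹ ^ j := by
      rw [← pow_mul (2⁻¹ : ℝ≥0∞), mul_comm j, pow_mul (2⁻¹ : ℝ≥0∞), ← mul_pow]
      gcongr
      rw [← ENNReal.inv_pow, ← div_eq_mul_inv]
      refine ENNReal.div_le_of_le_mul ?_
      calc (β : ℝ≥0∞) ^ 2 = 2⁻¹ * (2 * (β : ℝ≥0∞) ^ 2) := by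
            rw [← mul_assoc, ENNReal.inv_mul_cancel two_ne_zero ENNReal.ofNat_ne_top, one_mul]
        _ ≤ 2⁻¹ * 2 ^ finrank ℝ E := by gcongr
    calc ∫⁻ z in s j, g ‖z‖ ∂μ
        ≤ ∫⁻ _ in s j, (β : ℝ≥0∞) ^ (2 * (j + 2) + 2) * dyadicProfile g ρ ∂μ := by
          refine setLIntegral_mono_ae' (hsm j) ?_
          filter_upwards [hae] with z hz h using hz h.1 h.2
      _ = (β : ℝ≥0∞) ^ (2 * (j + 2) + 2) * dyadicProfile g ρ * μ (s j) := setLIntegral_const _ _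
      _ ≤ (β : ℝ≥0∞) ^ (2 * (j + 2) + 2) * dyadicProfile g ρ *
            ((2⁻¹ ^ j) ^ finrank ℝ E * μ (ball x R)) := by gcongr; exact hball j
      _ = (((β : ℝ≥0∞) ^ 2) ^ j * (2⁻¹ ^ j) ^ finrank ℝ E) *
            ((β : ℝ≥0∞) ^ 6 * dyadicProfile g ρ * μ (ball x R)) := by ring
      _ ≤ _ := by gcongr
  calc ∫⁻ z in ball 0 (ρ / 4), g ‖z‖ ∂μ ≤ ∫⁻ z in ⋃ j, s j, g ‖z‖ ∂μ :=
        lintegral_mono' (Measure.restrict_mono_ae hcover) le_rfl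
    _ ≤ ∑' j, ∫⁻ z in s j, g ‖z‖ ∂μ := lintegral_iUnion_le _ _
    _ ≤ ∑' j, 2⁻¹ ^ j * ((β : ℝ≥0∞) ^ 6 * dyadicProfile g ρ * μ (ball x R)) :=
        ENNReal.tsum_le_tsum hterm
    _ = _ := by
        rw [ENNReal.tsum_mul_right, ENNReal.tsum_geometric, ENNReal.one_sub_inv_two, inv_inv]
        ring

theorem ae_norm_le_dyadicProfile (hg : EssConstOnDyadicIntervals g β) (hβ : 1 ≤ β) {ρ : ℝ}
    (hρ : 0 < ρ) :
    ∀ᵐ z ∂μ, ρ / 8 ≤ ‖z‖ → ‖z‖ ≤ ρ →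
      g ‖z‖ ≤ (β : ℝ≥0∞) ^ 6 * dyadicProfile g ρ ∧
        dyadicProfile g ρ ≤ (β : ℝ≥0∞) ^ 7 * g ‖z‖ := by
  have hβ' : (1 : ℝ≥0∞) ≤ β := by exact_mod_cast hβ
  refine (ae_norm_iff μ (p := fun r ↦ ρ / 8 ≤ r → r ≤ ρ →
      g r ≤ (β : ℝ≥0∞) ^ 6 * dyadicProfile g ρ ∧
        dyadicProfile g ρ ≤ (β : ℝ≥0∞) ^ 7 * g r)).2 ?_
  filter_upwards [ae_le_dyadicProfile hg hβ hρ 0, ae_le_dyadicProfile hg hβ hρ 1,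
    ae_le_dyadicProfile hg hβ hρ 2] with r h₀ h₁ h₂ _ hr hr'
  have aux (k : ℕ) (hk : k ≤ 2) (h : g r ≤ (β : ℝ≥0∞) ^ (2 * k + 2) * dyadicProfile g ρ ∧
        dyadicProfile g ρ ≤ (β : ℝ≥0∞) ^ (2 * k + 3) * g r) :
      g r ≤ (β : ℝ≥0∞) ^ 6 * dyadicProfile g ρ ∧ dyadicProfile g ρ ≤ (β : ℝ≥0∞) ^ 7 * g r := by
    refine ⟨h.1.trans ?_, h.2.trans ?_⟩
    · gcongr
      omega
    · gcongr
      omega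
  norm_num at h₀ h₁ h₂
  rcases le_total (ρ / 2) r with h | h
  · exact aux 0 (by norm_num) (by simpa using h₀ h hr')
  rcases le_total (ρ / 4) r with h' | h'
  · exact aux 1 (by norm_num) (by simpa using h₁ h' h)
  · exact aux 2 (by norm_num) (by simpa using h₂ hr h')

theorem setLIntegral_ball_le (hg : EssConstOnDyadicIntervals g β) (hβ : 1 ≤ β)
    (hdim : 2 * (β : ℝ≥0∞) ^ 2 ≤ 2 ^ finrank ℝ E) (x : E) {R : ℝ} (hR : 0 < R) :
    ∫⁻ z in ball x R, g ‖z‖ ∂μ ≤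
      3 * (β : ℝ≥0∞) ^ 6 * dyadicProfile g (‖x‖ + R) * μ (ball x R) := by
  set ρ := ‖x‖ + R with hρdef
  have hρ : 0 < ρ := by positivity
  have hfar : ∫⁻ z in ball x R \ ball 0 (ρ / 4), g ‖z‖ ∂μ ≤
      (β : ℝ≥0∞) ^ 6 * dyadicProfile g ρ * μ (ball x R) := by
    calc ∫⁻ z in ball x R \ ball 0 (ρ / 4), g ‖z‖ ∂μ
        ≤ ∫⁻ z in ball x R \ ball 0 (ρ / 4), (β : ℝ≥0∞) ^ 6 * dyadicProfile g ρ ∂μ := by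
          refine setLIntegral_mono_ae' (measurableSet_ball.diff measurableSet_ball) ?_
          filter_upwards [ae_norm_le_dyadicProfile μ hg hβ hρ] with z hz h
          have h₁ := mem_ball_iff_norm.1 h.1
          have h₂ : ρ / 4 ≤ ‖z‖ := by simpa using h.2
          have h₃ := norm_le_norm_add_norm_sub' z x
          exact (hz (by linarith) (by linarith)).1
      _ = (β : ℝ≥0∞) ^ 6 * dyadicProfile g ρ * μ (ball x R \ ball 0 (ρ / 4)) :=
          setLIntegral_const _ _
      _ ≤ _ := by gcongr; exact sdiff_subset
  have hnear : ∫⁻ z in ball x R ∩ ball 0 (ρ / 4), g ‖z‖ ∂μ ≤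
      2 * (β : ℝ≥0∞) ^ 6 * dyadicProfile g ρ * μ (ball x R) := by
    rcases le_total ρ (4 * R) with h | h
    · exact (lintegral_mono_set inter_subset_right).trans
        (setLIntegral_ball_zero_le μ hg hβ hdim hρ h x)
    -- Here |x| = ρ - R ≥ 3R, so the ball stays away from the origin.
    · have : ball x R ∩ ball 0 (ρ / 4) = ∅ := by
        rw [← disjoint_iff_inter_eq_empty]
        apply ball_disjoint_ball
        rw [dist_zero_right]
        linarith
      simp [this]
  calc ∫⁻ z in ball x R, g ‖z‖ ∂μ = _ := (lintegral_inter_add_sdiff _ _ measurableSet_ball).symm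
    _ ≤ _ := add_le_add hnear hfar
    _ = _ := by ring

/-- At least half of the ball lies outside the ball of radius ρ/8 about the origin, and there `g` is
bounded below by the profile. -/
theorem le_setLIntegral_ball (hg : EssConstOnDyadicIntervals g β) (hβ : 1 ≤ β)
    (x : E) {R : ℝ} (hR : 0 < R) :
    dyadicProfile g (‖x‖ + R) * μ (ball x R) ≤
      2 * (β : ℝ≥0∞) ^ 7 * ∫⁻ z in ball x R, g ‖z‖ ∂μ := by
  set ρ := ‖x‖ + R with hρdef
  have hρ : 0 < ρ := by positivity
  have hhalf : μ (ball x R) ≤ 2 * μ (ball x R \ ball 0 (ρ / 8)) := by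
    have hsmall : μ (ball x R ∩ ball 0 (ρ / 8)) ≤ 2⁻¹ * μ (ball x R) := by
      rcases le_total ρ (4 * R) with h | h
      · calc μ (ball x R ∩ ball 0 (ρ / 8)) ≤ μ (ball 0 (R / 2 ^ 1)) := by
              refine measure_mono (inter_subset_right.trans (ball_subset_ball ?_))
              linarith
          _ = 2⁻¹ ^ finrank ℝ E * μ (ball x R) := by rw [addHaar_ball_div_two_pow μ x, pow_one]
          _ ≤ 2⁻¹ ^ 1 * μ (ball x R) := by
              gcongr ?_ * _
              exact pow_le_pow_right_of_le_one' (by simp) finrank_pos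
          _ = _ := by rw [pow_one]
      · have : ball x R ∩ ball 0 (ρ / 8) = ∅ := by
          rw [← disjoint_iff_inter_eq_empty]
          apply ball_disjoint_ball
          rw [dist_zero_right]
          linarith
        simp [this]
    have hsum := measure_inter_add_sdiff (μ := μ) (ball x R) (measurableSet_ball (x := (0 : E))
      (ε := ρ / 8))
    have htop : 2⁻¹ * μ (ball x R) ≠ ∞ :=
      ENNReal.mul_ne_top (by simp) measure_ball_lt_top.ne
    have h2 : 2⁻¹ * μ (ball x R) + 2⁻¹ * μ (ball x R) = μ (ball x R) := by
      rw [← add_mul, ENNReal.inv_two_add_inv_two, one_mul]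
    have : 2⁻¹ * μ (ball x R) ≤ μ (ball x R \ ball 0 (ρ / 8)) := by
      rw [← ENNReal.add_le_add_iff_left htop, h2]
      nth_rewrite 1 [← hsum]
      gcongr
    calc μ (ball x R) = 2 * (2⁻¹ * μ (ball x R)) := by
          rw [← mul_assoc, ENNReal.mul_inv_cancel two_ne_zero ENNReal.ofNat_ne_top, one_mul]
      _ ≤ _ := by gcongr
  calc dyadicProfile g ρ * μ (ball x R)
      ≤ dyadicProfile g ρ * (2 * μ (ball x R \ ball 0 (ρ / 8))) := by gcongr
    _ = 2 * ∫⁻ _ in ball x R \ ball 0 (ρ / 8), dyadicProfile g ρ ∂μ := by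
        rw [setLIntegral_const]; ring
    _ ≤ 2 * ∫⁻ z in ball x R \ ball 0 (ρ / 8), (β : ℝ≥0∞) ^ 7 * g ‖z‖ ∂μ := by
        gcongr 2 * ?_
        refine setLIntegral_mono_ae' (measurableSet_ball.diff measurableSet_ball) ?_
        filter_upwards [ae_norm_le_dyadicProfile μ hg hβ hρ] with z hz h
        have h₁ := mem_ball_iff_norm.1 h.1
        have h₂ : ρ / 8 ≤ ‖z‖ := by simpa using h.2
        have h₃ := norm_le_norm_add_norm_sub' z x
        exact (hz (by linarith) (by linarith)).2
    _ ≤ 2 * ∫⁻ z in ball x R, (β : ℝ≥0∞) ^ 7 * g ‖z‖ ∂μ := by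
        gcongr 2 * ?_
        exact lintegral_mono_set sdiff_subset
    _ = _ := by
        rw [lintegral_const_mul' _ _ (ENNReal.pow_ne_top ENNReal.coe_ne_top), mul_assoc]

end Sufficiency

theorem radialMeasure_ball (w₀ : ℝ≥0 → ℝ≥0) (n : ℕ) (x : EuclideanSpace ℝ (Fin n)) (R : ℝ) :
    radialMeasure w₀ n (ball x R) = ∫⁻ z in ball x R, (w₀ ‖z‖.toNNReal : ℝ≥0∞) := by
  rw [radialMeasure, withDensity_apply _ measurableSet_ball]
  simp only [norm_toNNReal]

theorem uniformlyWeaklyDoublingFrom_of_essConst {w₀ : ℝ≥0 → ℝ≥0} {β : ℝ≥0} (hβ : 1 ≤ β)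
    (hg : EssConstOnDyadicIntervals (fun t ↦ (w₀ t.toNNReal : ℝ≥0∞)) β) :
    ∃ N : ℕ, UniformlyWeaklyDoublingFrom w₀ N := by
  obtain ⟨N, hN⟩ := pow_unbounded_of_one_lt (2 * β ^ 2) (one_lt_two : (1 : ℝ≥0) < 2)
  set g : ℝ → ℝ≥0∞ := fun t ↦ (w₀ t.toNNReal : ℝ≥0∞)
  -- The constant is 3β⁶ (upper bound) times β⁴ (change of profile) times 2β⁷ (lower bound). The
  -- shift to N + 1 excludes dimension zero.
  refine ⟨N + 1, 6 * β ^ 17, by positivity, fun n hn ↦ ?_⟩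
  have : Nonempty (Fin n) := ⟨⟨0, by omega⟩⟩
  have hdim : 2 * (β : ℝ≥0∞) ^ 2 ≤ 2 ^ finrank ℝ (EuclideanSpace ℝ (Fin n)) := by
    rw [finrank_euclideanSpace_fin]
    have h₁ : 2 * β ^ 2 ≤ 2 ^ n := hN.le.trans (pow_le_pow_right₀ one_le_two (by omega))
    exact_mod_cast h₁
  constructor
  · refine ⟨fun x ↦ ⟨ball x 1, ball_mem_nhds x one_pos, ?_⟩⟩
    rw [radialMeasure_ball]
    refine (setLIntegral_ball_le volume hg hβ hdim x one_pos).trans_lt ?_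
    have := dyadicProfile_ne_top hg hβ (fun _ ↦ ENNReal.coe_ne_top)
      (show 0 < ‖x‖ + 1 by positivity)
    exact ENNReal.mul_lt_top (ENNReal.mul_lt_top (by finiteness) this.lt_top) measure_ball_lt_top
  · intro x y R hR hxy
    have hdist : dist x y < R + R := by
      obtain ⟨z, hz, hz'⟩ := hxy
      exact (dist_triangle_right x y z).trans_lt
        (add_lt_add (mem_ball'.1 hz) (mem_ball'.1 hz'))
    rw [dist_eq_norm] at hdist
    have h₁ := norm_le_norm_add_norm_sub' x y
    have h₂ := norm_le_norm_add_norm_sub x y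
    -- The centres are less than 2R apart, so the outer radii differ by a factor below 3 ≤ 2²: two
    -- doublings, each costing β².
    have hc : dyadicProfile g (‖y‖ + R) ≤ (β : ℝ≥0∞) ^ 4 * dyadicProfile g (‖x‖ + R) := by
      have hx := norm_nonneg x
      have hy := norm_nonneg y
      rcases le_total (‖x‖ + R) (‖y‖ + R) with h | h
      · exact (dyadicProfile_le_pow hg hβ (by positivity) h 2 (by linarith)).1
      · exact (dyadicProfile_le_pow hg hβ (by positivity) h 2 (by linarith)).2
    rw [radialMeasure_ball, radialMeasure_ball]
    calc ∫⁻ z in ball y R, g ‖z‖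
        ≤ 3 * (β : ℝ≥0∞) ^ 6 * dyadicProfile g (‖y‖ + R) * volume (ball y R) :=
          setLIntegral_ball_le volume hg hβ hdim y hR
      _ ≤ 3 * (β : ℝ≥0∞) ^ 6 * ((β : ℝ≥0∞) ^ 4 * dyadicProfile g (‖x‖ + R)) *
            volume (ball x R) := by
          rw [Measure.addHaar_ball_center volume y, Measure.addHaar_ball_center volume x]
          gcongr
      _ = 3 * (β : ℝ≥0∞) ^ 10 * (dyadicProfile g (‖x‖ + R) * volume (ball x R)) := by ring
      _ ≤ 3 * (β : ℝ≥0∞) ^ 10 * (2 * (β : ℝ≥0∞) ^ 7 * ∫⁻ z in ball x R, g ‖z‖) := by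
          gcongr _ * ?_
          exact le_setLIntegral_ball volume hg hβ x hR
      _ = _ := by push_cast; ring

/-! ### Changes of variable and averages on the line. -/

section Line

theorem hasDerivAt_sqrt_sq_add_sq {a t : ℝ} (ht : 0 < t) :
    HasDerivAt (fun t ↦ √(t ^ 2 + a ^ 2)) (t / √(t ^ 2 + a ^ 2)) t := by
  have h : t ^ 2 + a ^ 2 ≠ 0 := by positivity
  convert! ((hasDerivAt_pow 2 t).add_const (a ^ 2)).sqrt h using 1
  field_simp
  ring

theorem injOn_sqrt_sq_add_sq (a : ℝ) : InjOn (fun t ↦ √(t ^ 2 + a ^ 2)) (Ioi 0) := by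
  intro s (hs : 0 < s) t (ht : 0 < t) h
  have h' : s ^ 2 + a ^ 2 = t ^ 2 + a ^ 2 :=
    (Real.sqrt_inj (by positivity) (by positivity)).1 h
  exact (pow_left_inj₀ hs.le ht.le two_ne_zero).1 (by linarith)

/-- For t > R ≥ a the Jacobian t / √(t² + a²) is at least 1/2. -/
theorem setLIntegral_sqrt_sq_add_sq_le {a R : ℝ} (hR : 0 < R) (ha : 0 ≤ a) (haR : a ≤ R)
    (F : ℝ → ℝ≥0∞) :
    ∫⁻ t in Ioi R, F √(t ^ 2 + a ^ 2) ≤ 2 * ∫⁻ r, F r := by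
  have hcov := lintegral_image_eq_lintegral_abs_deriv_mul (measurableSet_Ioi (a := R))
    (fun t ht ↦ (hasDerivAt_sqrt_sq_add_sq (a := a) (hR.trans ht)).hasDerivWithinAt)
    ((injOn_sqrt_sq_add_sq a).mono (Ioi_subset_Ioi hR.le)) F
  calc ∫⁻ t in Ioi R, F √(t ^ 2 + a ^ 2)
      ≤ ∫⁻ t in Ioi R, 2 * (ENNReal.ofReal |t / √(t ^ 2 + a ^ 2)| * F √(t ^ 2 + a ^ 2)) := by
        refine setLIntegral_mono' measurableSet_Ioi fun t (ht : R < t) ↦ ?_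
        have ht0 : 0 < t := hR.trans ht
        rw [← mul_assoc]
        refine le_mul_of_one_le_left' ?_
        rw [← ENNReal.ofReal_ofNat, ← ENNReal.ofReal_mul (by norm_num), ← ENNReal.ofReal_one]
        refine ENNReal.ofReal_le_ofReal ?_
        have hpos : 0 < √(t ^ 2 + a ^ 2) := by positivity
        have hle : √(t ^ 2 + a ^ 2) ≤ 2 * t := Real.sqrt_le_iff.2 ⟨by positivity, by nlinarith⟩
        rw [abs_of_nonneg (by positivity), ← mul_div_assoc, one_le_div hpos]
        exact hle
    _ = 2 * ∫⁻ r in (fun t ↦ √(t ^ 2 + a ^ 2)) '' Ioi R, F r := by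
        rw [hcov, lintegral_const_mul' _ _ (by simp)]
    _ ≤ 2 * ∫⁻ r, F r := by gcongr 2 * ?_; exact setLIntegral_le_lintegral _ _

theorem setLIntegral_le_sqrt_sq_add_sq {a R : ℝ} (ha : 0 ≤ a) (haR : a ≤ R)
    (F : ℝ → ℝ≥0∞) :
    ∫⁻ r in Ioi R, F r ≤ ∫⁻ t in Ioi 0, F √(t ^ 2 + a ^ 2) := by
  have hcov := lintegral_image_eq_lintegral_abs_deriv_mul (measurableSet_Ioi (a := (0 : ℝ)))
    (fun t ht ↦ (hasDerivAt_sqrt_sq_add_sq (a := a) ht).hasDerivWithinAt)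
    (injOn_sqrt_sq_add_sq a) F
  have himage : Ioi R ⊆ (fun t ↦ √(t ^ 2 + a ^ 2)) '' Ioi 0 := by
    intro r (hr : R < r)
    refine ⟨√(r ^ 2 - a ^ 2), Real.sqrt_pos.2 (by nlinarith), ?_⟩
    have h : 0 ≤ r ^ 2 - a ^ 2 := by nlinarith
    simp only [Real.sq_sqrt h, sub_add_cancel]
    exact Real.sqrt_sq (by linarith)
  calc ∫⁻ r in Ioi R, F r ≤ ∫⁻ r in (fun t ↦ √(t ^ 2 + a ^ 2)) '' Ioi 0, F r :=
        lintegral_mono_set himage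
    _ = _ := hcov
    _ ≤ _ := by
        refine setLIntegral_mono' measurableSet_Ioi fun t (ht : 0 < t) ↦ ?_
        refine mul_le_of_le_one_left' ?_
        rw [← ENNReal.ofReal_one]
        refine ENNReal.ofReal_le_ofReal ?_
        have hpos : 0 < √(t ^ 2 + a ^ 2) := by positivity
        rw [abs_of_nonneg (by positivity), div_le_one hpos]
        exact Real.le_sqrt_of_sq_le (by nlinarith)

/-- By Tonelli, t is counted by the length of the set of centres whose interval contains it. That
length is at most 2h, vanishes outside radius κ + h and equals 2h within radius κ - h, whence the
next two bounds. -/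
theorem setLIntegral_setLIntegral_ball {f : ℝ → ℝ≥0∞} (hf : Measurable f) (s₀ κ h : ℝ) :
    ∫⁻ s in closedBall s₀ κ, ∫⁻ t in ball s h, f t =
      ∫⁻ t, f t * volume (closedBall s₀ κ ∩ ball t h) := by
  have hm : MeasurableSet {p : ℝ × ℝ | p.2 ∈ ball p.1 h} := by
    simp only [mem_ball]
    exact measurableSet_lt (by fun_prop) (by fun_prop)
  have h₁ (s : ℝ) : ∫⁻ t in ball s h, f t =
      ∫⁻ t, {p : ℝ × ℝ | p.2 ∈ ball p.1 h}.indicator (fun p ↦ f p.2) (s, t) := by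
    rw [← lintegral_indicator measurableSet_ball]
    rfl
  simp_rw [h₁]
  rw [lintegral_lintegral_swap]
  · refine lintegral_congr fun t ↦ ?_
    have h₂ (s : ℝ) : {p : ℝ × ℝ | p.2 ∈ ball p.1 h}.indicator (fun p ↦ f p.2) (s, t) =
        (ball t h).indicator (fun _ ↦ f t) s := by
      simp only [indicator, mem_ofPred_eq, mem_ball, dist_comm t s]
    simp_rw [h₂]
    rw [lintegral_indicator_const measurableSet_ball,
      Measure.restrict_apply measurableSet_ball, inter_comm]
  · exact ((hf.comp measurable_snd).indicator hm).aemeasurable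

theorem setLIntegral_setLIntegral_ball_le {f : ℝ → ℝ≥0∞} (hf : Measurable f) (s₀ κ h : ℝ) :
    ∫⁻ s in closedBall s₀ κ, ∫⁻ t in ball s h, f t ≤
      ENNReal.ofReal (2 * h) * ∫⁻ t in closedBall s₀ (κ + h), f t := by
  rw [setLIntegral_setLIntegral_ball hf, ← lintegral_indicator measurableSet_closedBall,
    ← lintegral_const_mul' _ _ ENNReal.ofReal_ne_top]
  refine lintegral_mono fun t ↦ ?_
  by_cases ht : t ∈ closedBall s₀ (κ + h)
  · rw [indicator_of_mem ht, mul_comm, ← Real.volume_ball t]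
    gcongr
    exact inter_subset_right
  · have : closedBall s₀ κ ∩ ball t h = ∅ := by
      rw [← disjoint_iff_inter_eq_empty]
      apply closedBall_disjoint_ball
      rw [mem_closedBall, not_le, dist_comm] at ht
      exact ht.le
    simp [this]

theorem le_setLIntegral_setLIntegral_ball {f : ℝ → ℝ≥0∞} (hf : Measurable f) (s₀ κ h : ℝ) :
    ENNReal.ofReal (2 * h) * ∫⁻ t in closedBall s₀ (κ - h), f t ≤
      ∫⁻ s in closedBall s₀ κ, ∫⁻ t in ball s h, f t := by
  rw [setLIntegral_setLIntegral_ball hf, ← lintegral_indicator measurableSet_closedBall,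
    ← lintegral_const_mul' _ _ ENNReal.ofReal_ne_top]
  refine lintegral_mono fun t ↦ ?_
  by_cases ht : t ∈ closedBall s₀ (κ - h)
  · have : closedBall s₀ κ ∩ ball t h = ball t h := by
      refine inter_eq_self_of_subset_right (ball_subset_closedBall.trans ?_)
      apply closedBall_subset_closedBall'
      rw [mem_closedBall] at ht
      linarith
    rw [indicator_of_mem ht, this, mul_comm, Real.volume_ball]
  · simp [indicator_of_notMem ht]

end Line

/-! ### Averages over a single chord. -/

section Slab

/-- The half-length of the chord of a ball of radius `R` at distance `a` from the centre. -/
noncomputable def halfChord (R a : ℝ) : ℝ := √(R ^ 2 - a ^ 2)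

variable {g : ℝ → ℝ≥0∞} {R s κ a : ℝ}

theorem halfChord_le (hR : 0 ≤ R) : halfChord R a ≤ R :=
  Real.sqrt_le_iff.2 ⟨hR, by nlinarith [sq_nonneg a]⟩

/-- A crude bound, to be used for long chords; its integral over [R, s + 3R] depends neither on `a`
nor on the dimension. -/
theorem setLIntegral_chord_le_of_lt (hg : Measurable g) (hR : 0 < R) (hs : 3 * R ≤ s)
    (hκ : κ < R) (ha : 0 ≤ a) (haR : a ≤ R) :
    ∫⁻ s' in closedBall s κ, ∫⁻ t in ball s' (halfChord R a), g √(t ^ 2 + a ^ 2) ≤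
      ENNReal.ofReal (2 * halfChord R a) * (2 * ∫⁻ r in Icc R (s + 3 * R), g r) := by
  refine (setLIntegral_setLIntegral_ball_le (by fun_prop) s κ _).trans ?_
  gcongr
  rw [← lintegral_indicator measurableSet_Icc]
  refine le_trans ?_ (setLIntegral_sqrt_sq_add_sq_le hR ha haR _)
  have hh := halfChord_le (R := R) (a := a) hR.le
  have hsub : closedBall s (κ + halfChord R a) ⊆ Ioi R := by
    rw [Real.closedBall_eq_Icc]
    intro t ht
    have := ht.1
    rw [mem_Ioi]
    linarith
  refine le_trans (setLIntegral_mono' measurableSet_closedBall fun t ht ↦ ?_)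
    (lintegral_mono_set hsub)
  have hRt : R < t := hsub ht
  rw [Real.closedBall_eq_Icc] at ht
  have := ht.2
  rw [indicator_of_mem]
  refine ⟨Real.le_sqrt_of_sq_le (by nlinarith), Real.sqrt_le_iff.2 ⟨by linarith, ?_⟩⟩
  have : t ≤ s + 2 * R := by linarith
  nlinarith

/-- With r² = t² + a², ρ² = s² + R² and h the half-chord, r² - ρ² = t² - s² - h². Since h ≤ κ/4 and
|t - s| ≤ 5κ/4, this forces |r - ρ| ≤ 2κ. -/
theorem setLIntegral_chord_le (hg : Measurable g) (hR : 0 < R) (hs : 3 * R ≤ s)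
    (hκ : κ < R) (ha : 0 ≤ a) (haR : a ≤ R) (hh : halfChord R a ≤ κ / 4) :
    ∫⁻ s' in closedBall s κ, ∫⁻ t in ball s' (halfChord R a), g √(t ^ 2 + a ^ 2) ≤
      ENNReal.ofReal (2 * halfChord R a) *
        (2 * ∫⁻ r in closedBall √(s ^ 2 + R ^ 2) (2 * κ), g r) := by
  refine (setLIntegral_setLIntegral_ball_le (by fun_prop) s κ _).trans ?_
  gcongr ENNReal.ofReal (2 * halfChord R a) * ?_
  rw [← lintegral_indicator
    (measurableSet_closedBall (x := √(s ^ 2 + R ^ 2)) (ε := 2 * κ))]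
  refine le_trans ?_ (setLIntegral_sqrt_sq_add_sq_le hR ha haR _)
  -- The choice s ≥ 3R keeps t above R, where the Jacobian bound applies.
  have hsub : closedBall s (κ + halfChord R a) ⊆ Ioi R := by
    rw [Real.closedBall_eq_Icc]
    intro t ht
    have := ht.1
    rw [mem_Ioi]
    linarith
  refine le_trans (setLIntegral_mono' measurableSet_closedBall fun t ht ↦ ?_)
    (lintegral_mono_set hsub)
  have hRt : R < t := hsub ht
  rw [Real.closedBall_eq_Icc] at ht
  obtain ⟨ht₁, ht₂⟩ := ht
  rw [indicator_of_mem]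
  have hh2 : R ^ 2 - a ^ 2 ≤ (κ / 4) ^ 2 := by
    have h0 : 0 ≤ R ^ 2 - a ^ 2 := by nlinarith
    rw [← Real.sq_sqrt h0]
    exact pow_le_pow_left₀ (Real.sqrt_nonneg _) hh 2
  have hκ0 : 0 ≤ κ := by
    have : 0 ≤ halfChord R a := Real.sqrt_nonneg _
    linarith
  set ρ := √(s ^ 2 + R ^ 2) with hρ
  set r := √(t ^ 2 + a ^ 2) with hr
  have hρ2 : ρ ^ 2 = s ^ 2 + R ^ 2 := Real.sq_sqrt (by positivity)
  have hr2 : r ^ 2 = t ^ 2 + a ^ 2 := Real.sq_sqrt (by positivity)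
  have hρs : s ≤ ρ := Real.le_sqrt_of_sq_le (by nlinarith)
  have hrt : t ≤ r := Real.le_sqrt_of_sq_le (by nlinarith)
  rw [Real.closedBall_eq_Icc]
  constructor
  · by_contra! hlt
    have : (ρ - r) * (ρ + r) ≤ (5 / 4 * κ) * (s + t) + κ ^ 2 / 16 := by
      nlinarith
    nlinarith
  · by_contra! hlt
    have : (r - ρ) * (ρ + r) ≤ (5 / 4 * κ) * (s + t) := by
      nlinarith
    nlinarith

/-- The same identity read backwards: |r - ρ| ≤ κ/4 forces |t - s| ≤ κ/2, and κ/2 ≤ κ - h. -/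
theorem le_setLIntegral_chord (hg : Measurable g) (hR : 0 < R) (hs : 3 * R ≤ s)
    (hκ : κ < R) (ha : 0 ≤ a) (haR : a ≤ R) (hh : halfChord R a ≤ κ / 4) :
    ENNReal.ofReal (2 * halfChord R a) * ∫⁻ r in closedBall √(s ^ 2 + R ^ 2) (κ / 4), g r ≤
      ∫⁻ s' in closedBall s κ, ∫⁻ t in ball s' (halfChord R a), g √(t ^ 2 + a ^ 2) := by
  refine le_trans ?_ (le_setLIntegral_setLIntegral_ball (by fun_prop) s κ _)
  gcongr ENNReal.ofReal (2 * halfChord R a) * ?_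
  have hh0 : 0 ≤ halfChord R a := Real.sqrt_nonneg _
  have hh2 : R ^ 2 - a ^ 2 ≤ (κ / 4) ^ 2 := by
    have h0 : 0 ≤ R ^ 2 - a ^ 2 := by nlinarith
    rw [← Real.sq_sqrt h0]
    exact pow_le_pow_left₀ (Real.sqrt_nonneg _) hh 2
  set ρ := √(s ^ 2 + R ^ 2) with hρ
  have hρ2 : ρ ^ 2 = s ^ 2 + R ^ 2 := Real.sq_sqrt (by positivity)
  have hρs : s ≤ ρ := Real.le_sqrt_of_sq_le (by nlinarith)
  have hρs' : ρ ≤ s + R := Real.sqrt_le_iff.2 ⟨by linarith, by nlinarith⟩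
  have hsub : closedBall ρ (κ / 4) ⊆ Ioi R := by
    rw [Real.closedBall_eq_Icc]
    intro t ht
    have := ht.1
    rw [mem_Ioi]
    linarith
  have hstep : ∫⁻ r in closedBall ρ (κ / 4), g r =
      ∫⁻ r in Ioi R, (closedBall ρ (κ / 4)).indicator g r := by
    rw [lintegral_indicator measurableSet_closedBall,
      Measure.restrict_restrict measurableSet_closedBall, inter_eq_self_of_subset_left hsub]
  rw [hstep, ← lintegral_indicator measurableSet_closedBall]
  refine (setLIntegral_le_sqrt_sq_add_sq ha haR _).trans ?_
  refine le_trans (setLIntegral_mono' measurableSet_Ioi fun t (ht : 0 < t) ↦ ?_)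
    (setLIntegral_le_lintegral (Ioi 0) _)
  by_cases hmem : √(t ^ 2 + a ^ 2) ∈ closedBall ρ (κ / 4)
  · rw [indicator_of_mem hmem, indicator_of_mem]
    set r := √(t ^ 2 + a ^ 2) with hr
    have hr2 : r ^ 2 = t ^ 2 + a ^ 2 := Real.sq_sqrt (by positivity)
    have hrt : r ≤ t + R := Real.sqrt_le_iff.2 ⟨by linarith, by nlinarith⟩
    have hr0 : 0 ≤ r := Real.sqrt_nonneg _
    rw [Real.closedBall_eq_Icc] at hmem ⊢
    obtain ⟨h₁, h₂⟩ := hmem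
    suffices κ / 2 ≤ κ - halfChord R a ∧ s - κ / 2 ≤ t ∧ t ≤ s + κ / 2 from
      ⟨by linarith, by linarith⟩
    refine ⟨by linarith, ?_, ?_⟩
    · by_contra! hlt
      have : (s - t) * (s + t) ≤ κ / 4 * (ρ + r) := by nlinarith
      nlinarith
    · by_contra! hlt
      have : (t - s) * (s + t) ≤ κ / 4 * (ρ + r) + κ ^ 2 / 16 := by nlinarith
      nlinarith
  · simp [indicator_of_notMem hmem]

end Slab

/-! ### Slicing balls along an axis; concentration on short chords. -/

section Axis

theorem nonempty_linearIsometryEquiv_prod (d : ℕ) :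
    Nonempty (WithLp 2 (ℝ × EuclideanSpace ℝ (Fin d)) ≃ₗᵢ[ℝ] EuclideanSpace ℝ (Fin (d + 1))) := by
  have h : finrank ℝ (WithLp 2 (ℝ × EuclideanSpace ℝ (Fin d))) = d + 1 := by
    rw [(WithLp.linearEquiv 2 ℝ (ℝ × EuclideanSpace ℝ (Fin d))).finrank_eq, finrank_prod,
      finrank_self, finrank_euclideanSpace_fin, add_comm]
  exact ⟨((stdOrthonormalBasis ℝ _).reindex (finCongr h)).repr⟩

theorem measurable_halfChord_norm {V : Type*} [NormedAddCommGroup V] [MeasurableSpace V]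
    [BorelSpace V] (R : ℝ) : Measurable fun v : V ↦ halfChord R ‖v‖ := by
  unfold halfChord
  fun_prop

theorem measurable_chordIntegral {V : Type*} [NormedAddCommGroup V] [MeasurableSpace V]
    [BorelSpace V] {g : ℝ → ℝ≥0∞} (hg : Measurable g) (R : ℝ) :
    Measurable fun p : ℝ × V ↦
      ∫⁻ t in ball p.1 (halfChord R ‖p.2‖), g √(t ^ 2 + ‖p.2‖ ^ 2) := by
  have hm : MeasurableSet {q : (ℝ × V) × ℝ | q.2 ∈ ball q.1.1 (halfChord R ‖q.1.2‖)} := by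
    simp only [mem_ball]
    refine measurableSet_lt (by fun_prop) ?_
    exact (measurable_halfChord_norm R).comp (by fun_prop)
  have : Measurable ({q : (ℝ × V) × ℝ | q.2 ∈ ball q.1.1 (halfChord R ‖q.1.2‖)}.indicator
      fun q ↦ g √(q.2 ^ 2 + ‖q.1.2‖ ^ 2)) := Measurable.indicator (by fun_prop) hm
  convert! this.lintegral_prod_right' (ν := volume) using 2 with p
  rw [← lintegral_indicator measurableSet_ball]
  rfl

theorem measurableSet_longChord {V : Type*} [NormedAddCommGroup V] [MeasurableSpace V]
    [BorelSpace V] (R κ : ℝ) :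
    MeasurableSet {v : V | κ / 4 < halfChord R ‖v‖} :=
  measurableSet_lt measurable_const (measurable_halfChord_norm R)

theorem halfChord_eq_zero {R a : ℝ} (hR : 0 ≤ R) (h : R ≤ a) : halfChord R a = 0 :=
  Real.sqrt_eq_zero_of_nonpos (by nlinarith)

variable {E V : Type*} [NormedAddCommGroup E] [InnerProductSpace ℝ E]
  [NormedAddCommGroup V] [InnerProductSpace ℝ V] (φ : WithLp 2 (ℝ × V) ≃ₗᵢ[ℝ] E)

/-- The point with coordinate `s` on the first axis of `E ≃ ℝ × V`. -/
noncomputable def axisPoint (s : ℝ) : E := φ (WithLp.toLp 2 (s, 0))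

theorem norm_apply_toLp (t : ℝ) (v : V) : ‖φ (WithLp.toLp 2 (t, v))‖ = √(t ^ 2 + ‖v‖ ^ 2) := by
  rw [φ.norm_map, eq_comm, Real.sqrt_eq_iff_mul_self_eq (by positivity) (norm_nonneg _), ← pow_two,
    WithLp.prod_norm_sq_eq_of_L2]
  simp

theorem dist_axisPoint (s s' : ℝ) : dist (axisPoint φ s) (axisPoint φ s') = |s - s'| := by
  rw [axisPoint, axisPoint, φ.dist_map, dist_eq_norm, ← WithLp.toLp_sub, Prod.mk_sub_mk, sub_zero,
    ← φ.norm_map, norm_apply_toLp]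
  simp [Real.sqrt_sq_eq_abs]

theorem apply_mem_ball_axisPoint_iff {s t R : ℝ} (hR : 0 < R) {v : V} :
    φ (WithLp.toLp 2 (t, v)) ∈ ball (axisPoint φ s) R ↔ t ∈ ball s (halfChord R ‖v‖) := by
  rw [mem_ball, axisPoint, φ.dist_map, dist_eq_norm, ← WithLp.toLp_sub, Prod.mk_sub_mk, sub_zero,
    ← φ.norm_map, norm_apply_toLp, mem_ball, Real.dist_eq, halfChord,
    Real.lt_sqrt (abs_nonneg _), Real.sqrt_lt' hR, sq_abs, lt_sub_iff_add_lt]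

variable [MeasurableSpace E] [BorelSpace E] [FiniteDimensional ℝ E]
  [MeasurableSpace V] [BorelSpace V] [FiniteDimensional ℝ V]

theorem setLIntegral_ball_axisPoint {g : ℝ → ℝ≥0∞} (hg : Measurable g) (s : ℝ) {R : ℝ}
    (hR : 0 < R) :
    ∫⁻ z in ball (axisPoint φ s) R, g ‖z‖ =
      ∫⁻ v : V, ∫⁻ t in ball s (halfChord R ‖v‖), g √(t ^ 2 + ‖v‖ ^ 2) := by
  have hψ : MeasurePreserving (fun p : ℝ × V ↦ φ (WithLp.toLp 2 p)) :=
    φ.measurePreserving.comp (WithLp.volume_preserving_toLp ℝ V)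
  have hm : MeasurableSet ((fun p : ℝ × V ↦ φ (WithLp.toLp 2 p)) ⁻¹' ball (axisPoint φ s) R) :=
    hψ.measurable measurableSet_ball
  rw [← hψ.setLIntegral_comp_preimage measurableSet_ball (by fun_prop),
    ← lintegral_indicator hm, Measure.volume_eq_prod, lintegral_prod_symm']
  · refine lintegral_congr fun v ↦ ?_
    rw [← lintegral_indicator measurableSet_ball]
    refine lintegral_congr fun t ↦ ?_
    have hiff : (t, v) ∈ (fun p : ℝ × V ↦ φ (WithLp.toLp 2 p)) ⁻¹' ball (axisPoint φ s) R ↔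
      t ∈ ball s (halfChord R ‖v‖) := apply_mem_ball_axisPoint_iff φ hR
    by_cases ht : t ∈ ball s (halfChord R ‖v‖)
    · rw [indicator_of_mem ht, indicator_of_mem (hiff.2 ht), norm_apply_toLp]
    · rw [indicator_of_notMem ht, indicator_of_notMem (mt hiff.1 ht)]
  · exact Measurable.indicator (hg.comp (measurable_norm.comp hψ.measurable)) hm

theorem volume_ball_axisPoint (s : ℝ) {R : ℝ} (hR : 0 < R) :
    volume (ball (axisPoint φ s) R) = ∫⁻ v : V, ENNReal.ofReal (2 * halfChord R ‖v‖) := by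
  have := setLIntegral_ball_axisPoint φ (g := fun _ ↦ 1) measurable_const s hR
  simpa [Real.volume_ball] using this

/-- Averaging the ball integrals over centres on an axis, computed chord by chord. -/
theorem setLIntegral_axis_eq {g : ℝ → ℝ≥0∞} (hg : Measurable g) (s κ : ℝ) {R : ℝ} (hR : 0 < R) :
    ∫⁻ s' in closedBall s κ, ∫⁻ z in ball (axisPoint φ s') R, g ‖z‖ =
      ∫⁻ v : V, ∫⁻ s' in closedBall s κ,
        ∫⁻ t in ball s' (halfChord R ‖v‖), g √(t ^ 2 + ‖v‖ ^ 2) := by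
  simp_rw [setLIntegral_ball_axisPoint φ hg _ hR]
  exact lintegral_lintegral_swap (measurable_chordIntegral hg R).aemeasurable

/-- The part of the volume of a ball of radius `R` carried by chords of half-length more than
`κ / 4`. -/
noncomputable def longChordVolume (V : Type*) [NormedAddCommGroup V] [InnerProductSpace ℝ V]
    [MeasurableSpace V] [BorelSpace V] [FiniteDimensional ℝ V] (R κ : ℝ) : ℝ≥0∞ :=
  ∫⁻ v in {v : V | κ / 4 < halfChord R ‖v‖}, ENNReal.ofReal (2 * halfChord R ‖v‖)

theorem setLIntegral_axis_le {g : ℝ → ℝ≥0∞} (hg : Measurable g) {s κ R : ℝ} (hR : 0 < R)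
    (hs : 3 * R ≤ s) (hκ : κ < R) :
    ∫⁻ s' in closedBall s κ, ∫⁻ z in ball (axisPoint φ s') R, g ‖z‖ ≤
      2 * (∫⁻ r in closedBall √(s ^ 2 + R ^ 2) (2 * κ), g r) * volume (ball (0 : E) R) +
        2 * (∫⁻ r in Icc R (s + 3 * R), g r) * longChordVolume V R κ := by
  set Y := ∫⁻ r in closedBall √(s ^ 2 + R ^ 2) (2 * κ), g r
  set G := ∫⁻ r in Icc R (s + 3 * R), g r
  rw [setLIntegral_axis_eq φ hg s κ hR, ← Measure.addHaar_ball_center volume (axisPoint φ s),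
    volume_ball_axisPoint φ s hR, longChordVolume,
    ← lintegral_indicator (measurableSet_longChord R κ)]
  have hmeas : Measurable fun v : V ↦ ENNReal.ofReal (2 * halfChord R ‖v‖) :=
    ((measurable_halfChord_norm R).const_mul 2).ennreal_ofReal
  rw [← lintegral_const_mul _ hmeas, ← lintegral_const_mul _
    (hmeas.indicator (measurableSet_longChord R κ)), ← lintegral_add_left (hmeas.const_mul _)]
  refine lintegral_mono fun v ↦ ?_
  rcases lt_or_ge R ‖v‖ with hv | hv
  · simp [halfChord_eq_zero hR.le hv.le]
  rcases lt_or_ge (κ / 4) (halfChord R ‖v‖) with hh | hh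
  · refine (setLIntegral_chord_le_of_lt hg hR hs hκ (norm_nonneg v) hv).trans ?_
    rw [indicator_of_mem (by exact hh)]
    refine le_trans (le_of_eq ?_) le_add_self
    ring
  · refine (setLIntegral_chord_le hg hR hs hκ (norm_nonneg v) hv hh).trans ?_
    refine le_trans (le_of_eq ?_) le_self_add
    ring

theorem le_setLIntegral_axis {g : ℝ → ℝ≥0∞} (hg : Measurable g) {s κ R : ℝ} (hR : 0 < R)
    (hs : 3 * R ≤ s) (hκ : κ < R) :
    (∫⁻ r in closedBall √(s ^ 2 + R ^ 2) (κ / 4), g r) * volume (ball (0 : E) R) ≤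
      (∫⁻ s' in closedBall s κ, ∫⁻ z in ball (axisPoint φ s') R, g ‖z‖) +
        (∫⁻ r in closedBall √(s ^ 2 + R ^ 2) (κ / 4), g r) * longChordVolume V R κ := by
  set X := ∫⁻ r in closedBall √(s ^ 2 + R ^ 2) (κ / 4), g r
  rw [setLIntegral_axis_eq φ hg s κ hR, ← Measure.addHaar_ball_center volume (axisPoint φ s),
    volume_ball_axisPoint φ s hR, longChordVolume,
    ← lintegral_indicator (measurableSet_longChord R κ)]
  have hmeas : Measurable fun v : V ↦ ENNReal.ofReal (2 * halfChord R ‖v‖) :=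
    ((measurable_halfChord_norm R).const_mul 2).ennreal_ofReal
  have hmeas' := hmeas.indicator (measurableSet_longChord (V := V) R κ)
  rw [← lintegral_const_mul _ hmeas, ← lintegral_const_mul _ hmeas',
    ← lintegral_add_right _ (hmeas'.const_mul _)]
  refine lintegral_mono fun v ↦ ?_
  rcases lt_or_ge R ‖v‖ with hv | hv
  · simp [halfChord_eq_zero hR.le hv.le]
  rcases lt_or_ge (κ / 4) (halfChord R ‖v‖) with hh | hh
  · rw [indicator_of_mem (by exact hh)]
    exact le_add_self
  · refine le_trans ?_ le_self_add
    rw [mul_comm]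
    exact le_setLIntegral_chord hg hR hs hκ (norm_nonneg v) hv hh

/-- In high dimension, long chords carry an exponentially small part of the volume of a ball. -/
theorem longChordVolume_le (φ : WithLp 2 (ℝ × V) ≃ₗᵢ[ℝ] E) {κ R : ℝ} (hκ : 0 < κ) (hκR : κ < R) :
    longChordVolume V R κ ≤ ENNReal.ofReal (8 * R / κ) *
      ENNReal.ofReal (√(R ^ 2 - (κ / 4) ^ 2) / √(R ^ 2 - (κ / 8) ^ 2)) ^ finrank ℝ V *
        volume (ball (0 : E) R) := by
  set a := √(R ^ 2 - (κ / 4) ^ 2) with ha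
  set b := √(R ^ 2 - (κ / 8) ^ 2) with hb
  have hR : 0 < R := hκ.trans hκR
  have ha0 : 0 < a := Real.sqrt_pos.2 (by nlinarith)
  have hb0 : 0 < b := Real.sqrt_pos.2 (by nlinarith)
  have ha2 : a ^ 2 = R ^ 2 - (κ / 4) ^ 2 := Real.sq_sqrt (by nlinarith)
  have hb2 : b ^ 2 = R ^ 2 - (κ / 8) ^ 2 := Real.sq_sqrt (by nlinarith)
  -- A half-chord above κ/4 means ‖v‖ < a, and no chord is longer than 2R.
  have hupper : longChordVolume V R κ ≤ ENNReal.ofReal (2 * R) * volume (ball (0 : V) a) := by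
    calc longChordVolume V R κ ≤ ∫⁻ v in {v : V | κ / 4 < halfChord R ‖v‖}, ENNReal.ofReal (2 * R) :=
          lintegral_mono fun v ↦ ENNReal.ofReal_le_ofReal (by linarith [halfChord_le (a := ‖v‖) hR.le])
      _ = ENNReal.ofReal (2 * R) * volume {v : V | κ / 4 < halfChord R ‖v‖} := setLIntegral_const _ _
      _ ≤ _ := by
          gcongr
          intro v hv
          rw [mem_ball_zero_iff]
          have := (Real.lt_sqrt (by positivity)).1 hv
          exact Real.lt_sqrt_of_sq_lt (by linarith)
  -- Over the larger ball of radius b > a every chord still has length at least κ/4; the ratio (a/b)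
  -- ^ dim V supplies the decay.
  have hlower : ENNReal.ofReal (κ / 4) * volume (ball (0 : V) b) ≤ volume (ball (0 : E) R) := by
    rw [← Measure.addHaar_ball_center volume (axisPoint φ 0), volume_ball_axisPoint φ 0 hR]
    calc ENNReal.ofReal (κ / 4) * volume (ball (0 : V) b)
        = ∫⁻ _ in ball (0 : V) b, ENNReal.ofReal (κ / 4) := (setLIntegral_const _ _).symm
      _ ≤ ∫⁻ v in ball (0 : V) b, ENNReal.ofReal (2 * halfChord R ‖v‖) := by
          refine setLIntegral_mono' measurableSet_ball fun v hv ↦ ENNReal.ofReal_le_ofReal ?_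
          rw [mem_ball_zero_iff] at hv
          have : κ / 8 ≤ halfChord R ‖v‖ := Real.le_sqrt_of_sq_le (by nlinarith [norm_nonneg v])
          linarith
      _ ≤ _ := setLIntegral_le_lintegral _ _
  calc longChordVolume V R κ ≤ ENNReal.ofReal (2 * R) * volume (ball (0 : V) a) := hupper
    _ = ENNReal.ofReal (2 * R) * (ENNReal.ofReal ((a / b) ^ finrank ℝ V) *
          volume (ball (0 : V) b)) := by
        rw [← Measure.addHaar_ball_mul_of_pos volume 0 (by positivity) b, div_mul_cancel₀ _ hb0.ne']
    _ = ENNReal.ofReal (8 * R / κ) * ENNReal.ofReal (a / b) ^ finrank ℝ V *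
          (ENNReal.ofReal (κ / 4) * volume (ball (0 : V) b)) := by
        have : 2 * R = 8 * R / κ * (κ / 4) := by field_simp; ring
        rw [this, ENNReal.ofReal_mul (by positivity), ENNReal.ofReal_pow (by positivity)]
        ring
    _ ≤ _ := by gcongr

theorem tendsto_longChord_ratio {κ R : ℝ} (hκ : 0 < κ) (hκR : κ < R) :
    Tendsto (fun d : ℕ ↦ ENNReal.ofReal (8 * R / κ) *
      ENNReal.ofReal (√(R ^ 2 - (κ / 4) ^ 2) / √(R ^ 2 - (κ / 8) ^ 2)) ^ d) atTop (𝓝 0) := by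
  have hb0 : 0 < √(R ^ 2 - (κ / 8) ^ 2) := Real.sqrt_pos.2 (by nlinarith)
  have h1 : ENNReal.ofReal (√(R ^ 2 - (κ / 4) ^ 2) / √(R ^ 2 - (κ / 8) ^ 2)) < 1 := by
    rw [← ENNReal.ofReal_one, ENNReal.ofReal_lt_ofReal_iff one_pos, div_lt_one hb0]
    exact Real.sqrt_lt_sqrt (by nlinarith) (by nlinarith)
  simpa using ENNReal.Tendsto.const_mul (ENNReal.tendsto_pow_atTop_nhds_zero_of_lt_one h1)
    (Or.inr ENNReal.ofReal_ne_top)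

end Axis

/-! ### From uniform doubling to the density. -/

section Necessity

/-- Chains balls whose centres lie on the segment from x to y with spacing at most R; consecutive
balls meet at the midpoint of their centres. -/
theorem IsWeaklyDoublingWith.measure_ball_le {E : Type*} [NormedAddCommGroup E] [NormedSpace ℝ E]
    [MeasurableSpace E] {μ : Measure E} {K : ℝ≥0} (h : IsWeaklyDoublingWith μ K) {R : ℝ}
    (hR : 0 < R) (m : ℕ) {x y : E} (hxy : dist x y ≤ m * R) :
    μ (ball y R) ≤ (K : ℝ≥0∞) ^ m * μ (ball x R) := by
  induction m generalizing y with
  | zero =>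
    obtain rfl : x = y := dist_le_zero.1 (by simpa using hxy)
    simp
  | succ m ih =>
    set z := AffineMap.lineMap x y ((m : ℝ) / (m + 1)) with hz
    have hxz : dist x z ≤ m * R := by
      rw [hz, dist_left_lineMap, Real.norm_of_nonneg (by positivity), div_mul_eq_mul_div,
        div_le_iff₀ (by positivity)]
      push_cast at hxy
      nlinarith [Nat.cast_nonneg (α := ℝ) m]
    have hzy : dist z y ≤ R := by
      have h1 : 1 - (m : ℝ) / (m + 1) = 1 / (m + 1) := by field_simp; ring
      rw [hz, dist_lineMap_right, h1, Real.norm_of_nonneg (by positivity), div_mul_eq_mul_div,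
        div_le_iff₀ (by positivity)]
      push_cast at hxy
      linarith
    have hne : (ball z R ∩ ball y R).Nonempty := by
      refine ⟨midpoint ℝ z y, ?_, ?_⟩
      · rw [mem_ball, dist_midpoint_left, Real.norm_ofNat]; linarith
      · rw [mem_ball, dist_midpoint_right, Real.norm_ofNat]; linarith
    calc μ (ball y R) ≤ K * μ (ball z R) := h z y R hR hne
      _ ≤ K * ((K : ℝ≥0∞) ^ m * μ (ball x R)) := by gcongr; exact ih hxz
      _ = _ := by ring

/-- Away from the origin the polar weight is at least a ^ (n - 1), so finite ball masses in one
dimension already bound integrals on the line. -/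
theorem setLIntegral_Icc_lt_top {E : Type*} [NormedAddCommGroup E] [NormedSpace ℝ E]
    [MeasurableSpace E] [BorelSpace E] [FiniteDimensional ℝ E] [Nontrivial E] (μ : Measure E)
    [μ.IsAddHaarMeasure] {g : ℝ → ℝ≥0∞} (hg : Measurable g)
    (h : ∀ R : ℝ, ∫⁻ z in ball 0 R, g ‖z‖ ∂μ < ∞) {a : ℝ} (ha : 0 < a) (b : ℝ) :
    ∫⁻ r in Icc a b, g r < ∞ := by
  set f : ℝ → ℝ≥0∞ := (Icc a b).indicator g
  have hf : Measurable f := hg.indicator measurableSet_Icc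
  have h₁ : ∫⁻ z, f ‖z‖ ∂μ < ∞ := by
    refine lt_of_le_of_lt ?_ (h (b + 1))
    rw [← lintegral_indicator measurableSet_ball]
    refine lintegral_mono fun z ↦ ?_
    by_cases hz : ‖z‖ ∈ Icc a b
    · rw [indicator_of_mem (show z ∈ ball 0 (b + 1) by
        rw [mem_ball_zero_iff]; linarith [hz.2])]
      exact (indicator_of_mem hz g).le
    · exact (indicator_of_notMem hz g).trans_le zero_le
  rw [lintegral_fun_norm μ hf] at h₁
  have hsphere : μ.toSphere univ ≠ 0 := by
    rw [Ne, Measure.measure_univ_eq_zero]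
    exact μ.toSphere_ne_zero
  replace h₁ := ENNReal.lt_top_of_mul_ne_top_right h₁.ne hsphere
  set c := ENNReal.ofReal (a ^ (finrank ℝ E - 1))
  have hc : c ≠ 0 := by simpa [c] using pow_pos ha _
  have h₂ : c * ∫⁻ r in Icc a b, g r < ∞ := by
    refine lt_of_le_of_lt ?_ h₁
    rw [← lintegral_const_mul' _ _ ENNReal.ofReal_ne_top]
    calc ∫⁻ r in Icc a b, c * g r
        ≤ ∫⁻ r in Icc a b, ENNReal.ofReal (r ^ (finrank ℝ E - 1)) * f r := by
          refine setLIntegral_mono' measurableSet_Icc fun r hr ↦ ?_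
          rw [show f r = g r from indicator_of_mem hr g]
          exact mul_le_mul' (ENNReal.ofReal_le_ofReal (pow_le_pow_left₀ ha.le hr.1 _)) le_rfl
      _ ≤ _ := lintegral_mono_set fun r hr ↦ ha.trans_le hr.1
  exact ENNReal.lt_top_of_mul_ne_top_right h₂.ne hc

theorem setLIntegral_axis_le_setLIntegral_axis {E V : Type*} [NormedAddCommGroup E]
    [InnerProductSpace ℝ E] [NormedAddCommGroup V] [InnerProductSpace ℝ V]
    (φ : WithLp 2 (ℝ × V) ≃ₗᵢ[ℝ] E) {C : ℝ≥0∞} (hC : C ≠ ∞) {ν : E → ℝ≥0∞} {s₁ s₂ κ : ℝ}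
    (h : ∀ x y : E, dist x y = |s₁ - s₂| → ν y ≤ C * ν x) :
    ∫⁻ s in closedBall s₂ κ, ν (axisPoint φ s) ≤
      C * ∫⁻ s in closedBall s₁ κ, ν (axisPoint φ s) := by
  rw [← lintegral_const_mul' _ _ hC, ← lintegral_indicator measurableSet_closedBall,
    ← lintegral_indicator measurableSet_closedBall, ← lintegral_add_right_eq_self _ (s₂ - s₁)]
  refine lintegral_mono fun s ↦ ?_
  by_cases hs : s ∈ closedBall s₁ κ
  · have hs' : s + (s₂ - s₁) ∈ closedBall s₂ κ := by
      rw [mem_closedBall, Real.dist_eq] at hs ⊢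
      convert! hs using 2
      ring
    rw [indicator_of_mem hs, indicator_of_mem hs']
    refine h _ _ ?_
    rw [dist_axisPoint]
    congr 1
    ring
  · have hs' : s + (s₂ - s₁) ∉ closedBall s₂ κ := by
      rw [mem_closedBall, Real.dist_eq] at hs ⊢
      convert! hs using 3
      ring
    rw [indicator_of_notMem hs, indicator_of_notMem hs']

/-- Uniform comparability of balls in all high dimensions passes to intervals of the line. -/
theorem setLIntegral_closedBall_le_of_forall_dim {g : ℝ → ℝ≥0∞} (hg : Measurable g)
    (hfin : ∀ a b : ℝ, 0 < a → ∫⁻ r in Icc a b, g r < ∞) {R s₁ s₂ κ : ℝ} (hκ : 0 < κ) (hκR : κ < R)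
    (hs₁ : 3 * R ≤ s₁) (hs₂ : 3 * R ≤ s₂) {C : ℝ≥0∞} (hC : C ≠ ∞) {N : ℕ}
    (h : ∀ d : ℕ, N ≤ d → ∀ x y : EuclideanSpace ℝ (Fin (d + 1)), dist x y = |s₁ - s₂| →
      ∫⁻ z in ball y R, g ‖z‖ ≤ C * ∫⁻ z in ball x R, g ‖z‖) :
    ∫⁻ r in closedBall √(s₂ ^ 2 + R ^ 2) (κ / 4), g r ≤
      2 * C * ∫⁻ r in closedBall √(s₁ ^ 2 + R ^ 2) (2 * κ), g r := by
  have hR : 0 < R := hκ.trans hκR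
  set X := ∫⁻ r in closedBall √(s₂ ^ 2 + R ^ 2) (κ / 4), g r
  set Y := ∫⁻ r in closedBall √(s₁ ^ 2 + R ^ 2) (2 * κ), g r
  set G := ∫⁻ r in Icc R (s₁ + 3 * R), g r
  -- Finiteness of X and G, which do not depend on d, is what lets the error (2CG + X) q d tend to
  -- zero.
  have hX : X ≠ ∞ := by
    have : s₂ ≤ √(s₂ ^ 2 + R ^ 2) := Real.le_sqrt_of_sq_le (by nlinarith)
    simp only [X, Real.closedBall_eq_Icc]
    exact (hfin _ _ (by linarith)).ne
  have hG : G ≠ ∞ := (hfin _ _ hR).ne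
  set q : ℕ → ℝ≥0∞ := fun d ↦ ENNReal.ofReal (8 * R / κ) *
      ENNReal.ofReal (√(R ^ 2 - (κ / 4) ^ 2) / √(R ^ 2 - (κ / 8) ^ 2)) ^ d with hq
  have hbound (d : ℕ) (hd : N ≤ d) : X ≤ 2 * C * Y + (2 * C * G + X) * q d := by
    obtain ⟨φ⟩ := nonempty_linearIsometryEquiv_prod d
    set B := volume (ball (0 : EuclideanSpace ℝ (Fin (d + 1))) R)
    have hB : B ≠ ∞ := measure_ball_lt_top.ne
    have hB0 : B ≠ 0 := (measure_ball_pos _ _ hR).ne'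
    have hlong := longChordVolume_le φ hκ hκR
    rw [finrank_euclideanSpace_fin] at hlong
    set L := longChordVolume (EuclideanSpace ℝ (Fin d)) R κ
    rw [← ENNReal.mul_le_mul_iff_left hB0 hB]
    calc X * B ≤ _ := le_setLIntegral_axis φ hg hR hs₂ hκR
      _ ≤ C * (2 * Y * B + 2 * G * L) + X * L := by
          gcongr
          refine (setLIntegral_axis_le_setLIntegral_axis φ hC
            (ν := fun x ↦ ∫⁻ z in ball x R, g ‖z‖) (h d hd)).trans ?_
          gcongr
          exact setLIntegral_axis_le φ hg hR hs₁ hκR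
      _ ≤ C * (2 * Y * B + 2 * G * (q d * B)) + X * (q d * B) := by gcongr
      _ = _ := by ring
  have hlim : Tendsto (fun d ↦ 2 * C * Y + (2 * C * G + X) * q d) atTop (𝓝 (2 * C * Y)) := by
    have := ENNReal.Tendsto.const_mul (a := 2 * C * G + X) (tendsto_longChord_ratio hκ hκR)
      (Or.inr (by finiteness))
    simpa using this.const_add (2 * C * Y)
  refine ge_of_tendsto hlim ?_
  filter_upwards [eventually_ge_atTop N] with d hd using hbound d hd

/-- If balls of equal radius at distance at most eight radii have comparable masses, uniformly
in high dimensions, then the density is essentially constant on dyadic intervals. -/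
theorem essConstOnDyadicIntervals_of_forall_dim {g : ℝ → ℝ≥0∞} (hg : Measurable g)
    (hfin : ∀ a b : ℝ, 0 < a → ∫⁻ r in Icc a b, g r < ∞) {C : ℝ≥0} {N : ℕ}
    (h : ∀ d : ℕ, N ≤ d → ∀ R : ℝ, 0 < R → ∀ x y : EuclideanSpace ℝ (Fin (d + 1)),
      dist x y ≤ 8 * R → ∫⁻ z in ball y R, g ‖z‖ ≤ C * ∫⁻ z in ball x R, g ‖z‖) :
    EssConstOnDyadicIntervals g (16 * C) := by
  intro R₀ hR₀
  -- Each radius ρ in [4R, 8R] is √(s² + R²) with 3R ≤ s ≤ 8R, so two such centres are at most 8R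
  -- apart. Truncating `g` to [R, 16R] gives the integrability needed for Lebesgue differentiation
  -- without affecting the small intervals around ρ.
  set R := R₀ / 4 with hRdef
  have hR : 0 < R := by positivity
  set f : ℝ → ℝ≥0∞ := (Icc R (16 * R)).indicator g with hf
  have hfm : Measurable f := hg.indicator measurableSet_Icc
  have hfint : ∫⁻ r, f r ≠ ∞ := by
    rw [hf, lintegral_indicator measurableSet_Icc]
    exact (hfin _ _ hR).ne
  have hleb : ∀ᵐ ρ : ℝ, Tendsto
      (fun κ ↦ (∫⁻ r in closedBall ρ κ, f r) / volume (closedBall ρ κ)) (𝓝[>] 0) (𝓝 (f ρ)) := by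
    filter_upwards [(Besicovitch.vitaliFamily (volume : Measure ℝ)).ae_tendsto_lintegral_div'
      hfm hfint] with ρ hρ
    exact hρ.comp (Besicovitch.tendsto_filterAt volume ρ)
  have hf_eq {ρ κ : ℝ} (hρ : R₀ ≤ ρ ∧ ρ ≤ 2 * R₀) (hκ : κ ≤ 2 * R) :
      ∫⁻ r in closedBall ρ κ, f r = ∫⁻ r in closedBall ρ κ, g r := by
    refine setLIntegral_congr_fun measurableSet_closedBall fun r hr ↦ indicator_of_mem ?_ g
    rw [Real.closedBall_eq_Icc] at hr
    exact ⟨by linarith [hr.1, hρ.1], by linarith [hr.2, hρ.2]⟩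
  have hscale {c : ℝ} (hc : 0 < c) : Tendsto (fun κ : ℝ ↦ c * κ) (𝓝[>] 0) (𝓝[>] 0) := by
    refine tendsto_nhdsWithin_iff.2 ⟨?_, ?_⟩
    · exact tendsto_nhdsWithin_of_tendsto_nhds (by simpa using (continuous_const_mul c).tendsto 0)
    · filter_upwards [self_mem_nhdsWithin] with κ hκ using mul_pos hc hκ
  filter_upwards [hleb] with ρ₂ hlim₂ hρ₂
  filter_upwards [hleb] with ρ₁ hlim₁ hρ₁
  have hmem {ρ : ℝ} (hρ : R₀ ≤ ρ ∧ ρ ≤ 2 * R₀) : f ρ = g ρ :=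
    indicator_of_mem (show ρ ∈ Icc R (16 * R) from ⟨by linarith [hρ.1], by linarith [hρ.2]⟩) g
  have hs {ρ : ℝ} (hρ : R₀ ≤ ρ ∧ ρ ≤ 2 * R₀) : ∃ s, 3 * R ≤ s ∧ s ≤ 8 * R ∧
      √(s ^ 2 + R ^ 2) = ρ := by
    refine ⟨√(ρ ^ 2 - R ^ 2), Real.le_sqrt_of_sq_le (by nlinarith [hρ.1]),
      Real.sqrt_le_iff.2 ⟨by positivity, by nlinarith [hρ.1, hρ.2]⟩, ?_⟩
    rw [Real.sq_sqrt (by nlinarith [hρ.1]), sub_add_cancel]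
    exact Real.sqrt_sq (by linarith [hρ.1])
  obtain ⟨s₁, hs₁, hs₁', rfl⟩ := hs hρ₁
  obtain ⟨s₂, hs₂, hs₂', rfl⟩ := hs hρ₂
  rw [← hmem hρ₁, ← hmem hρ₂]
  -- The averages have radii κ/4 at ρ₂ and 2κ at ρ₁. The ratio 8 of the lengths, times the factor 2C
  -- of the integral bound, gives 16C.
  refine le_of_tendsto_of_tendsto (hlim₂.comp (hscale (c := 1 / 4) (by norm_num)))
    (ENNReal.Tendsto.const_mul (hlim₁.comp (hscale two_pos)) (Or.inr ENNReal.coe_ne_top)) ?_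
  filter_upwards [Ioo_mem_nhdsGT hR] with κ hκ
  have hdist : |s₁ - s₂| ≤ 8 * R := abs_le.2 ⟨by linarith, by linarith⟩
  have hmain := setLIntegral_closedBall_le_of_forall_dim hg hfin hκ.1 hκ.2 hs₁ hs₂
    (ENNReal.coe_ne_top (r := C)) fun d hd x y hxy ↦ h d hd R hR x y (hxy.trans_le hdist)
  have hκ4 : 1 / 4 * κ = κ / 4 := by ring
  simp only [Function.comp_apply]
  rw [hf_eq hρ₂ (by linarith [hκ.1, hκ.2]), hf_eq hρ₁ (by linarith [hκ.1, hκ.2]), hκ4,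
    Real.volume_closedBall, Real.volume_closedBall]
  set t := ENNReal.ofReal (2 * (κ / 4)) with ht
  have ht4 : ENNReal.ofReal (2 * (2 * κ)) = 8 * t := by
    rw [ht, ← ENNReal.ofReal_ofNat, ← ENNReal.ofReal_mul (by norm_num)]
    congr 1
    ring
  have ht0 : t ≠ 0 := by simpa [ht] using hκ.1
  have htop : t ≠ ∞ := ENNReal.ofReal_ne_top
  rw [ht4, ENNReal.div_le_iff ht0 htop]
  refine hmain.trans_eq ?_
  push_cast
  set Y := ∫⁻ r in closedBall √(s₁ ^ 2 + R ^ 2) (2 * κ), g r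
  have h8 : Y / (8 * t) * (8 * t) = Y :=
    ENNReal.div_mul_cancel (mul_ne_zero (by norm_num) ht0) (by finiteness)
  calc 2 * (C : ℝ≥0∞) * Y = 2 * C * (Y / (8 * t) * (8 * t)) := by rw [h8]
    _ = _ := by ring

end Necessity

/-! ### Assembling the equivalence. -/

theorem EssConstOnDyadicIntervals.congr_ae {f g : ℝ → ℝ≥0∞} {β : ℝ≥0}
    (hf : EssConstOnDyadicIntervals f β) (hfg : f =ᵐ[volume] g) :
    EssConstOnDyadicIntervals g β := by
  intro R hR
  filter_upwards [hf R hR, hfg] with r hr hr' hrR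
  filter_upwards [hr hrR, hfg] with s hs hs' hsR
  rw [← hr', ← hs']
  exact hs hsR

theorem EssConstOnDyadicIntervals.mono {g : ℝ → ℝ≥0∞} {β γ : ℝ≥0}
    (hg : EssConstOnDyadicIntervals g β) (hβγ : β ≤ γ) : EssConstOnDyadicIntervals g γ := by
  intro R hR
  filter_upwards [hg R hR] with r hr hrR
  filter_upwards [hr hrR] with s hs hsR
  exact (hs hsR).trans (by gcongr)

theorem essConst_of_uniformlyWeaklyDoublingFrom {w₀ : ℝ≥0 → ℝ≥0}
    (hw₀ : AEMeasurable (fun t : ℝ ↦ w₀ t.toNNReal) volume) {N : ℕ}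
    (h : UniformlyWeaklyDoublingFrom w₀ N) :
    ∃ β : ℝ≥0, 1 ≤ β ∧ EssConstOnDyadicIntervals (fun t ↦ (w₀ t.toNNReal : ℝ≥0∞)) β := by
  obtain ⟨K, -, hK⟩ := h
  -- A measurable representative makes Tonelli available; by polar coordinates it changes no ball
  -- mass in positive dimension.
  set g : ℝ → ℝ≥0∞ := fun t ↦ (hw₀.mk _ t : ℝ≥0∞) with hg
  have hgm : Measurable g := hw₀.measurable_mk.coe_nnreal_ennreal
  have hgae : (fun t : ℝ ↦ (w₀ t.toNNReal : ℝ≥0∞)) =ᵐ[volume] g := by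
    filter_upwards [hw₀.ae_eq_mk] with t ht
    simp only [hg, ← ht]
  have hball (d : ℕ) (x : EuclideanSpace ℝ (Fin (d + 1))) (R : ℝ) :
      radialMeasure w₀ (d + 1) (ball x R) = ∫⁻ z in ball x R, g ‖z‖ := by
    rw [radialMeasure_ball]
    refine lintegral_congr_ae (ae_restrict_of_ae ?_)
    refine (ae_norm_iff volume (p := fun t ↦ (w₀ t.toNNReal : ℝ≥0∞) = g t)).2 ?_
    filter_upwards [hgae] with t ht _ using ht
  have hfin (a b : ℝ) (ha : 0 < a) : ∫⁻ r in Icc a b, g r < ∞ := by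
    have := (hK (N + 1) (by omega)).1
    refine setLIntegral_Icc_lt_top (volume : Measure (EuclideanSpace ℝ (Fin (N + 1)))) hgm
      (fun R ↦ ?_) ha b
    rw [← hball]
    exact measure_ball_lt_top
  have hess := essConstOnDyadicIntervals_of_forall_dim hgm hfin (C := K ^ 8) (N := N)
    fun d hd R hR x y hxy ↦ by
      rw [← hball, ← hball]
      exact_mod_cast (hK (d + 1) (by omega)).2.measure_ball_le hR 8 hxy
  exact ⟨max 1 (16 * K ^ 8), le_max_left _ _, (hess.mono (le_max_right _ _)).congr_ae hgae.symm⟩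

/-- For a measurable `w₀ : [0, ∞) → [0, ∞)` the following are equivalent: the measures
`w₀(|x|) dx` are uniformly weakly doubling in `ℝⁿ` for all `n ≥ N`, for some `N`; the density is
essentially constant on the dyadic annuli of all the spaces `ℝⁿ`, `n ≥ 1`, with one constant `β`;
the density is essentially constant on the dyadic annuli of one space `ℝⁿ`, `n ≥ 1`. -/
theorem theorem3p3 (w₀ : ℝ≥0 → ℝ≥0) 
    (hw₀ : AEMeasurable (fun t : ℝ => w₀ t.toNNReal) volume) :
    List.TFAE [
      ∃ N : ℕ, UniformlyWeaklyDoublingFrom w₀ N,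
      ∃ β : ℝ≥0, 1 ≤ β ∧ ∀ n : ℕ, 1 ≤ n → EssConstOnDyadicAnnuli w₀ n β,
      ∃ n : ℕ, 1 ≤ n ∧ ∃ β : ℝ≥0, 1 ≤ β ∧ EssConstOnDyadicAnnuli w₀ n β] := by
  have hiff {n : ℕ} (hn : 1 ≤ n) {β : ℝ≥0} (hβ : 1 ≤ β) :=
    essConstOnDyadicAnnuli_iff (w₀ := w₀) hn hβ
  tfae_have 1 → 2 := by
    rintro ⟨N, hN⟩
    obtain ⟨β, hβ, h⟩ := essConst_of_uniformlyWeaklyDoublingFrom hw₀ hN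
    exact ⟨β, hβ, fun n hn ↦ (hiff hn hβ).2 h⟩
  tfae_have 2 → 3 := fun ⟨β, hβ, h⟩ ↦ ⟨1, le_rfl, β, hβ, h 1 le_rfl⟩
  tfae_have 3 → 1 := by
    rintro ⟨n, hn, β, hβ, h⟩
    exact uniformlyWeaklyDoublingFrom_of_essConst hβ ((hiff hn hβ).1 h)
  tfae_finish
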